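/- Let $\mathcal X$ be a measurable space, $\mathcal Y=\{0,1\}$, and let $\mathcal H\subseteq\{0,1\}^{\mathcal X}$ be a non-empty class of measurable binary hypotheses of finite VC dimension $d$ such that, for every $n$, a hypothesis of $\mathcal H$ consistent with a labelled sample of size $n$ (if one exists) can be chosen measurably (a standard regularity condition; it holds e.g. if $\mathcal H$ has a countable subset of which every member of $\mathcal H$ is a pointwise limit). Let $\ell:\mathcal Y\times(\mathcal X\times\mathcal Y)\to[0,1]$ be a measurable loss, where $\ell(y,z)$ is the loss of predicting $y$ on the example $z$. For a probability distribution $D$ on $\mathcal X\times\mathcal Y$ and a randomized hypothesis $g:\mathcal X\to\Delta(\mathcal Y)$ put $\mathcal L_D(g)=\mathbb E_{(x,y)\sim D}\,\mathbb E_{\hat y\sim g(x)}\,\ell(\hat y,(x,y))$. In personalized multi-distribution learning with $k\ge 1$ unknown distributions $D_1,\dots,D_k$ on $\mathcal X\times\mathcal Y$, a learner makes $m$ adaptive queries: at time $t$ it chooses an index $i_t\in[k]$ as a function of the transcript $(x_1,y_1,i_1),\dots,(x_{t-1},y_{t-1},i_{t-1})$ and receives an independent sample $(x_t,y_t)\sim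 D_{i_t}$. As a function of the final transcript it then returns one (possibly randomized) hypothesis $g_i$ for each $i\in[k]$. The class $\mathcal H$ is learnable in the personalized setting with sample complexity $m_{\mathcal H}:(0,1)^2\times\mathbb N\to\mathbb N$ if for every $k\ge1$ there is such a learner for which, for all $\epsilon,\delta\in(0,1)$ and all $D_1,\dots,D_k$, after $m=m_{\mathcal H}(\epsilon,\delta,k)$ queries, with probability at least $1-\delta$, $$\max_{i\in[k]}\mathcal L_{D_i}(g_i)\;\le\;\epsilon+\inf_{h\in\mathcal H}\max_{i\in[k]}\mathcal L_{D_i}(h).$$ Theorem. $\mathcal H$ is learnable in the personalized setting with a sample complexity $$m_{\mathcal H}(\epsilon,\delta,k)\in\tilde O\!\left(\epsilon^{-2}\,\ln(k)\left(d\ln\!\left(\tfrac{dk}{\epsilon}\right)+k\ln\!\left(\tfrac{k}{\delta}\right)\right)\right).$$ Here $\tilde O$ hides a universal constant and double-logarithmic factors: there are universal constants $C>0$ and $p\in\mathbb N$, independent of $\mathcal X,\mathcal H,\ell,d,\epsilon,\delta,k$, such that for all $\epsilon,\delta\in(0,1)$ and $k\ge1$ $$m_{\mathcal H}(\epsilon,\delta,k)\le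 C\,\epsilon^{-2}\max\{1,\ln k\}\left(d\ln\!\left(\tfrac{dk}{\epsilon}\right)+k\ln\!\left(\tfrac{k}{\delta}\right)\right)\left(1+\ln\!\left(1+\ln\tfrac{(d+1)k}{\epsilon\delta}\right)\right)^{p},$$ where $d\ln(dk/\epsilon)$ is read as $0$ if $d=0$. -/

import Mathlib

open MeasureTheory

/-- A finite set of points is shattered by a class of binary hypotheses if every labelling of the
points is realized by some hypothesis of the class. -/
def ShattersFinset {X : Type*} (H : Set (X → Bool)) (S : Finset X) : Prop :=
  ∀ b : X → Bool, ∃ h ∈ H, ∀ x ∈ S, h x = b x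

/-- The VC dimension of a class of binary hypotheses: the supremum of the sizes of the finite sets
that it shatters. -/
noncomputable def classVCDim {X : Type*} (H : Set (X → Bool)) : ℕ∞ :=
  ⨆ (S : Finset X) (_ : ShattersFinset H S), (S.card : ℕ∞)

/-- The usual measurability requirement on a class of binary hypotheses: each hypothesis is
measurable, and a hypothesis of the class that is consistent with a labelled sample (if there is
one) can be chosen measurably. Countable classes of measurable hypotheses have this property,
and so do classes with a countable subclass of which every hypothesis is a pointwise limit. -/
structure MeasurableClass {X : Type*} [MeasurableSpace X] (H : Set (X → Bool)) : Prop where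
  measurable_mem : ∀ h ∈ H, Measurable h
  measurable_selection : ∀ n : ℕ, ∃ σ : (Fin n → X × Bool) → X → Bool,
    (∀ s, σ s ∈ H) ∧
    Measurable (fun p : (Fin n → X × Bool) × X => σ p.1 p.2) ∧
    ∀ s, (∃ h ∈ H, ∀ j, h (s j).1 = (s j).2) → ∀ j, σ s (s j).1 = (s j).2

/-- The expected loss `𝔼_{z ∼ D} ℓ(g, z)` of a randomized hypothesis `g : X → Δ({0,1})`, where
`ℓ y z` is the loss of predicting the label `y` on the example `z = (x, y')`. -/
noncomputable def risk {X : Type*} [MeasurableSpace X] (ℓ : Bool → X × Bool → ℝ)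
    (D : Measure (X × Bool)) (g : X → PMF Bool) : ℝ :=
  ∫ z, ∑ y : Bool, (g z.1 y).toReal * ℓ y z ∂D

/-- `OPT`: the least worst-case expected loss (over the `k` distributions) of a single
hypothesis of the class. -/
noncomputable def opt {X : Type*} [MeasurableSpace X] (ℓ : Bool → X × Bool → ℝ)
    (H : Set (X → Bool)) {k : ℕ} (D : Fin k → Measure (X × Bool)) : ℝ :=
  ⨅ h : H, ⨆ i : Fin k, risk ℓ (D i) (fun x => PMF.pure (h.1 x))

/-- A personalized multi-distribution learning algorithm for `k` distributions. From the
transcript of the examples seen so far, each with the index of the oracle that returned it, the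
function `query` chooses the oracle to be called next, and `output` returns one randomized
hypothesis for each distribution. -/
structure PersonalizedLearner (X : Type*) [MeasurableSpace X] (k : ℕ) where
  query : List (X × Bool × Fin k) → Fin k
  output : List (X × Bool × Fin k) → Fin k → X → PMF Bool
  measurable_output : ∀ s i y, Measurable fun x => output s i x y

/-- The transcript of the first `m` oracle calls. The entry `ω t i` is the example that oracle
`i` returns if it is called at time `t`; of `ω t` only the entry of the chosen oracle is seen. -/
def PersonalizedLearner.transcript {X : Type*} [MeasurableSpace X] {k : ℕ}
    (A : PersonalizedLearner X k) :
    (m : ℕ) → (Fin m → Fin k → X × Bool) → List (X × Bool × Fin k)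
  | 0, _ => []
  | m + 1, ω =>
    let s := A.transcript m (Fin.init ω)
    let i := A.query s
    s ++ [((ω (Fin.last m) i).1, (ω (Fin.last m) i).2, i)]

/-- `H` is learnable in the personalized multi-distribution setting with `m ε δ k` samples:
for each number `k ≥ 1` of distributions there is an algorithm such that for all `ε, δ ∈ (0,1)`
and all distributions `D 0, …, D (k - 1)`, after `m ε δ k` oracle calls with independent answers
it returns hypotheses `g 0, …, g (k - 1)` with `max_i risk (D i) (g i) ≤ ε + OPT`, except on an
event of (outer) probability at most `δ`. -/
def PersonalizedLearnable {X : Type*} [MeasurableSpace X] (ℓ : Bool → X × Bool → ℝ)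
    (H : Set (X → Bool)) (m : ℝ → ℝ → ℕ → ℕ) : Prop :=
  ∀ k : ℕ, 1 ≤ k → ∃ A : PersonalizedLearner X k,
    ∀ ε ∈ Set.Ioo (0 : ℝ) 1, ∀ δ ∈ Set.Ioo (0 : ℝ) 1,
      ∀ (D : Fin k → Measure (X × Bool)) [∀ i, IsProbabilityMeasure (D i)],
        (Measure.pi fun _ : Fin (m ε δ k) => Measure.pi D)
          {ω | ¬ ∀ i, risk ℓ (D i) (A.output (A.transcript (m ε δ k) ω) i) ≤ ε + opt ℓ H D}
          ≤ ENNReal.ofReal δ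

/-!
The learner works in epochs of `R = log₂ k + 1` rounds. During an epoch it maintains `2 * k` slots,
each assigned to a distribution; initially every distribution has two of them. In a round it finds a
single hypothesis of `H` that is nearly optimal on at least half of the slots, retires these slots
with that hypothesis, and doubles each of the remaining slots. As long as none of the slots of a
distribution is retired, their number doubles in each round, while all of them lie among the `k`
slots that are kept; so every distribution has a slot retired in some round
(`RoundRule.exists_retires`), and the hypothesis of that round is returned for it.

One round (`exists_round`) costs `6 * k * N` queries: a cover, a training and a test sample, each
with `N` examples per slot. The cover only serves to replace `H` by the finitely many hypotheses
that the measurable consistent learner returns for the possible labellings of the cover. By the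
Sauer–Shelah lemma there are at most `(2 * k * N + 1) ^ d` of them, and by an exchange argument
between the cover and the training sample (`measure_mismatch_le`) one of them nearly agrees on the
training sample with a fixed near-optimal `f ∈ H`. Given the cover, Hoeffding's inequality and a
union bound control the training losses of all candidates on all halves of the slots simultaneously.
The learner takes the candidate whose training loss on the worst half of the slots is least. On
every half the mean of its expected losses is at most `opt` up to the accuracy, hence fewer than
half of the slots have a larger expected loss. The test sample, which is independent of the
hypothesis, is used to select a half of the slots with a small loss; no estimate of `opt` is needed.
All choices are made measurably, because the sample of a round must be independent of the state at
its start (`RoundRule.measure_round_le`).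

The learner does not know `ε` and `δ`. It doubles `N` after each epoch and returns the hypotheses of
the last epoch; `m ε δ k` is the end of an epoch whose `N` just suffices (`exists_epoch`). There
`N` is of the order `ε⁻² ((d / k) ln (d k / ε) Λ + ln (k / δ) + 1)`, where the double logarithm `Λ`
absorbs the logarithm of `N` itself. Two cases in which the bound can be arbitrarily close to `0`
need no queries: for `d = 0` the class has one element, and for `ε ≥ 1 / 2` a fair coin will do.
-/

/-! ### Measurable minimizers -/

theorem exists_measurable_argmin {Ω ι : Type*} [MeasurableSpace Ω] [Finite ι] [Nonempty ι]
    (c : ι → Ω → ℝ) (hc : ∀ i, Measurable (c i)) :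
    ∃ s : Ω → ι, (∀ i, MeasurableSet {ω | s ω = i}) ∧ ∀ ω j, c (s ω) ω ≤ c j ω := by
  classical
  obtain ⟨n, ⟨e⟩⟩ := Finite.exists_equiv_fin ι
  let p : Ω → ℕ → Prop := fun ω a => ∃ i, (e i : ℕ) = a ∧ ∀ j, c i ω ≤ c j ω
  have hp : ∀ ω, ∃ a, p ω a := fun ω => by
    obtain ⟨i, hi⟩ := Finite.exists_min (fun i => c i ω)
    exact ⟨e i, i, rfl, hi⟩
  have hpm : ∀ a, MeasurableSet {ω | p ω a} := by
    intro a
    have : {ω | p ω a} = ⋃ i, ⋃ (_ : (e i : ℕ) = a), ⋂ j, {ω | c i ω ≤ c j ω} := by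
      ext ω; simp [p]
    rw [this]
    exact MeasurableSet.iUnion fun i => MeasurableSet.iUnion fun _ =>
      MeasurableSet.iInter fun j => measurableSet_le (hc i) (hc j)
  refine ⟨fun ω => (Nat.find_spec (hp ω)).choose, fun i => ?_, fun ω j =>
    (Nat.find_spec (hp ω)).choose_spec.2 j⟩
  have : {ω | (Nat.find_spec (hp ω)).choose = i} = (fun ω => Nat.find (hp ω)) ⁻¹' {(e i : ℕ)} := by
    ext ω
    have h1 := (Nat.find_spec (hp ω)).choose_spec.1
    simp only [Set.mem_ofPred_eq, Set.mem_preimage, Set.mem_singleton_iff]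
    refine ⟨fun h => ?_, fun h => e.injective (Fin.ext (h1.trans h))⟩
    exact h1.symm.trans (by rw [h])
  rw [this]
  exact measurable_find hp hpm (measurableSet_singleton _)

/-! ### The number of labellings realized on finitely many points -/

theorem sum_choose_le_pow (n d : ℕ) : ∑ j ∈ Finset.Iic d, n.choose j ≤ (n + 1) ^ d := by
  induction d with
  | zero => simp [show Finset.Iic 0 = {0} from rfl]
  | succ d ih =>
    have h1 : n.choose (d + 1) ≤ n * (n + 1) ^ d := by
      calc n.choose (d + 1) ≤ n ^ (d + 1) := Nat.choose_le_pow n (d + 1)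
        _ = n * n ^ d := by ring
        _ ≤ n * (n + 1) ^ d := by gcongr; omega
    have h2 : Finset.Iic (d + 1) = insert (d + 1) (Finset.Iic d) := by
      ext x; simp only [Finset.mem_Iic, Finset.mem_insert]; omega
    rw [h2, Finset.sum_insert (by simp)]
    calc _ ≤ n * (n + 1) ^ d + (n + 1) ^ d := add_le_add h1 ih
      _ = _ := by ring

/-- The labellings of a family of points (repetitions are allowed) that some hypothesis of the
class realizes. -/
noncomputable def realizedLabellings {X I : Type*} [Fintype I] [DecidableEq I] (H : Set (X → Bool))
    (x : I → X) : Finset (I → Bool) :=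
  open Classical in {b | ∃ h ∈ H, ∀ i, h (x i) = b i}

/-- The Sauer–Shelah bound on the growth function. Points may repeat in `x`; a set of indices on
which all labellings are realized carries distinct points. -/
theorem card_realizedLabellings_le {X I : Type*} [Fintype I] [DecidableEq I] {H : Set (X → Bool)}
    {d : ℕ} (hd : classVCDim H ≤ d) (x : I → X) :
    (realizedLabellings H x).card ≤ (Fintype.card I + 1) ^ d := by
  classical
  let F : (I → Bool) → Finset I := fun b => {i | b i = true}
  have hF : Function.Injective F := by
    intro b b' h
    ext i
    have : i ∈ F b ↔ i ∈ F b' := by rw [h]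
    simpa [F] using this
  rw [← Finset.card_image_of_injective _ hF]
  set 𝒜 := (realizedLabellings H x).image F
  have hvc : 𝒜.vcDim ≤ d := by
    refine Finset.sup_le fun s hs => ?_
    rw [Finset.mem_shatterer] at hs
    have key : ∀ t ⊆ s, ∃ h ∈ H, ∀ i ∈ s, (h (x i) = true ↔ i ∈ t) := by
      intro t ht
      obtain ⟨u, hu, hut⟩ := hs ht
      obtain ⟨b, hb, rfl⟩ := Finset.mem_image.1 hu
      obtain ⟨h, hH, hb⟩ : ∃ h ∈ H, ∀ i, h (x i) = b i := by
        simpa [realizedLabellings] using hb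
      refine ⟨h, hH, fun i hi => ?_⟩
      rw [← hut]
      simp [F, hi, hb]
    have hinj : Set.InjOn x s := by
      intro i hi j hj hij
      obtain ⟨h, -, hh⟩ := key {i} (by simpa using hi)
      have h1 := (hh i hi).2 (by simp)
      rw [hij] at h1
      have := (hh j hj).1 h1
      exact (Finset.mem_singleton.1 this).symm
    have hsh : ShattersFinset H (s.image x) := by
      intro b
      obtain ⟨h, hH, hh⟩ := key (s.filter fun i => b (x i) = true) (Finset.filter_subset _ _)
      refine ⟨h, hH, fun y hy => ?_⟩
      obtain ⟨i, hi, rfl⟩ := Finset.mem_image.1 hy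
      have := hh i hi
      rw [Bool.eq_iff_iff]
      simpa [hi] using this
    have h1 : ((s.image x).card : ℕ∞) ≤ classVCDim H :=
      le_iSup₂ (f := fun (S : Finset X) (_ : ShattersFinset H S) => (S.card : ℕ∞)) _ hsh
    rw [Finset.card_image_of_injOn hinj] at h1
    exact_mod_cast h1.trans hd
  calc 𝒜.card ≤ 𝒜.shatterer.card := Finset.card_le_card_shatterer 𝒜
    _ ≤ ∑ j ∈ Finset.Iic 𝒜.vcDim, (Fintype.card I).choose j :=
        Finset.card_shatterer_le_sum_vcDim
    _ ≤ ∑ j ∈ Finset.Iic d, (Fintype.card I).choose j :=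
        Finset.sum_le_sum_of_subset (Finset.Iic_subset_Iic.2 hvc)
    _ ≤ _ := sum_choose_le_pow _ _

/-! ### Hoeffding's inequality for product measures -/

theorem pi_hoeffding {I Z : Type*} [Fintype I] [MeasurableSpace Z] (P : I → Measure Z)
    [∀ i, IsProbabilityMeasure (P i)] (f : I → Z → ℝ) (hf : ∀ i, Measurable (f i))
    (h01 : ∀ i z, f i z ∈ Set.Icc (0 : ℝ) 1) (s : Finset I) {t : ℝ} (ht : 0 ≤ t) :
    (Measure.pi P) {ω | t ≤ ∑ i ∈ s, (f i (ω i) - ∫ z, f i z ∂P i)} ≤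
      ENNReal.ofReal (Real.exp (-2 * t ^ 2 / s.card)) := by
  have hind := ProbabilityTheory.iIndepFun_pi (μ := P)
    (X := fun i z => f i z - ∫ z, f i z ∂P i) (fun i => ((hf i).sub_const _).aemeasurable)
  have hsub : ∀ i ∈ s, ProbabilityTheory.HasSubgaussianMGF
      (fun ω : I → Z => f i (ω i) - ∫ z, f i z ∂P i) ((‖(1 : ℝ) - 0‖₊ / 2) ^ 2)
      (Measure.pi P) := by
    intro i _
    have h := ProbabilityTheory.hasSubgaussianMGF_of_mem_Icc (μ := Measure.pi P)
      (X := fun ω : I → Z => f i (ω i)) (a := 0) (b := 1)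
      ((hf i).comp (measurable_pi_apply i)).aemeasurable (ae_of_all _ fun ω => h01 i (ω i))
    have hint : ∫ ω, f i (ω i) ∂(Measure.pi P) = ∫ z, f i z ∂P i := by
      have hm := measurePreserving_eval P i
      conv_rhs => rw [← hm.map_eq]
      rw [integral_map hm.measurable.aemeasurable (hf i).aestronglyMeasurable]
    rwa [hint] at h
  have h := ProbabilityTheory.HasSubgaussianMGF.measure_sum_ge_le_of_iIndepFun hind hsub ht
  rw [← ENNReal.ofReal_toReal (measure_ne_top (Measure.pi P) _)]
  refine ENNReal.ofReal_le_ofReal (h.trans (le_of_eq ?_))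
  congr 1
  simp only [sub_zero, nnnorm_one, Finset.sum_const, nsmul_eq_mul]
  push_cast
  rcases Nat.eq_zero_or_pos s.card with h0 | h0
  · simp [h0]
  · field_simp

theorem pi_hoeffding_neg {I Z : Type*} [Fintype I] [MeasurableSpace Z] (P : I → Measure Z)
    [∀ i, IsProbabilityMeasure (P i)] (f : I → Z → ℝ) (hf : ∀ i, Measurable (f i))
    (h01 : ∀ i z, f i z ∈ Set.Icc (0 : ℝ) 1) (s : Finset I) {t : ℝ} (ht : 0 ≤ t) :
    (Measure.pi P) {ω | t ≤ ∑ i ∈ s, (∫ z, f i z ∂P i - f i (ω i))} ≤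
      ENNReal.ofReal (Real.exp (-2 * t ^ 2 / s.card)) := by
  have h := pi_hoeffding P (fun i z => 1 - f i z) (fun i => (hf i).const_sub 1)
    (fun i z => ⟨by linarith [(h01 i z).2], by linarith [(h01 i z).1]⟩) s ht
  have hi : ∀ i, ∫ z, (1 - f i z) ∂P i = 1 - ∫ z, f i z ∂P i := by
    intro i
    rw [integral_sub (integrable_const _) (Integrable.of_mem_Icc 0 1 (hf i).aemeasurable
      (ae_of_all _ (h01 i)))]
    simp
  simp only [hi] at h
  convert h using 6
  ring

/-! ### Exchanging two samples -/

/-- Exchange the entries of two samples at the indices selected by `τ`. -/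
def exchange {I Z : Type*} (τ : I → Bool) (c : (I → Z) × (I → Z)) : (I → Z) × (I → Z) :=
  (fun i => if τ i then c.2 i else c.1 i, fun i => if τ i then c.1 i else c.2 i)

theorem measurePreserving_exchange {I Z : Type*} [Fintype I] [MeasurableSpace Z]
    (P : I → Measure Z) [∀ i, IsProbabilityMeasure (P i)] (τ : I → Bool) :
    MeasurePreserving (exchange τ) ((Measure.pi P).prod (Measure.pi P))
      ((Measure.pi P).prod (Measure.pi P)) := by
  have h1 := measurePreserving_arrowProdEquivProdArrow Z Z I P P
  have h2 : MeasurePreserving (fun (w : I → Z × Z) i => (if τ i then Prod.swap else id) (w i))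
      (Measure.pi fun i => (P i).prod (P i)) (Measure.pi fun i => (P i).prod (P i)) := by
    refine measurePreserving_pi _ _ fun i => ?_
    split_ifs
    · exact Measure.measurePreserving_swap
    · exact MeasurePreserving.id _
  have h3 := (h1.comp h2).comp (h1.symm)
  convert h3 using 1
  ext c i
  · simp only [exchange, Function.comp_apply]
    change _ = (((if τ i then Prod.swap else id) (c.1 i, c.2 i)) : Z × Z).1
    split_ifs <;> rfl
  · simp only [exchange, Function.comp_apply]
    change _ = (((if τ i then Prod.swap else id) (c.1 i, c.2 i)) : Z × Z).2
    split_ifs <;> rfl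

/-- The combinatorial core of the exchange argument: given two samples, few of the exchanges make a
hypothesis of the class agree with the target on the first sample and disagree with it `m` times on
the second. The labelling of all the points by the hypothesis determines the exchange at each of
the indices where it disagrees with the target. -/
theorem card_exchange_le {X I : Type*} [Fintype I] [DecidableEq I] {H : Set (X → Bool)} {d : ℕ}
    (hd : classVCDim H ≤ d) (f : X → Bool) (x : Bool × I → X) (A : (I → Bool) → X → Bool)
    (hA : ∀ τ, A τ ∈ H) (m : ℕ) :
    (Finset.univ.filter fun τ : I → Bool => (∀ i, A τ (x (τ i, i)) = f (x (τ i, i))) ∧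
      m ≤ (Finset.univ.filter fun i => A τ (x (!τ i, i)) ≠ f (x (!τ i, i))).card).card * 2 ^ m ≤
      (2 * Fintype.card I + 1) ^ d * 2 ^ Fintype.card I := by
  classical
  set T := Finset.univ.filter fun τ : I → Bool => (∀ i, A τ (x (τ i, i)) = f (x (τ i, i))) ∧
      m ≤ (Finset.univ.filter fun i => A τ (x (!τ i, i)) ≠ f (x (!τ i, i))).card with hT
  let L : (I → Bool) → (Bool × I → Bool) := fun τ p => A τ (x p)
  rcases T.eq_empty_or_nonempty with h0 | ⟨τ₁, hτ₁⟩
  · rw [h0]; simp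
  have hm : m ≤ Fintype.card I :=
    (Finset.mem_filter.1 hτ₁).2.2.trans (Finset.card_le_univ _)
  have hfib : ∀ b ∈ realizedLabellings H x,
      (T.filter fun τ => L τ = b).card ≤ 2 ^ (Fintype.card I - m) := by
    intro b _
    rcases (T.filter fun τ => L τ = b).eq_empty_or_nonempty with h0 | ⟨τ₀, hτ₀⟩
    · rw [h0]; simp
    let M : Finset I := {i | b (!τ₀ i, i) ≠ f (x (!τ₀ i, i))}
    obtain ⟨hT₀, hL₀⟩ := Finset.mem_filter.1 hτ₀
    obtain ⟨-, h₀1, h₀2⟩ := Finset.mem_filter.1 hT₀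
    have hM : m ≤ M.card := by
      refine h₀2.trans (le_of_eq ?_)
      congr 1
      ext i
      simp only [M, Finset.mem_filter, ← hL₀, L]
    -- Where `b` disagrees with `f`, all exchanges in the fibre put the disagreement second.
    have hsub : (T.filter fun τ => L τ = b) ⊆
        Fintype.piFinset fun i => if i ∈ M then {τ₀ i} else Finset.univ := by
      intro τ hτ
      obtain ⟨hTτ, hLτ⟩ := Finset.mem_filter.1 hτ
      obtain ⟨-, h1, -⟩ := Finset.mem_filter.1 hTτ
      rw [Fintype.mem_piFinset]
      intro i
      split_ifs with hi
      · have hi' : b (!τ₀ i, i) ≠ f (x (!τ₀ i, i)) := by simpa [M] using hi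
        have h2 : b (τ i, i) = f (x (τ i, i)) := by rw [← hLτ]; exact h1 i
        rw [Finset.mem_singleton]
        by_contra hne
        have : τ i = !τ₀ i := by
          revert hne; cases τ i <;> cases τ₀ i <;> simp
        rw [this] at h2
        exact hi' h2
      · simp
    refine (Finset.card_le_card hsub).trans ?_
    rw [Fintype.card_piFinset]
    have : ∀ i, (if i ∈ M then ({τ₀ i} : Finset Bool) else Finset.univ).card =
        if i ∈ M then 1 else 2 := by
      intro i; split_ifs <;> simp
    simp only [this]
    rw [Finset.prod_ite]
    simp only [Finset.prod_const_one, one_mul, Finset.prod_const]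
    refine Nat.pow_le_pow_right (by norm_num) ?_
    have h3 : (Finset.univ.filter fun i => i ∉ M) = Mᶜ := by ext; simp
    rw [h3, Finset.card_compl]
    omega
  have hmaps : ∀ τ ∈ T, L τ ∈ realizedLabellings H x := fun τ _ => by
    simp only [realizedLabellings, Finset.mem_filter, Finset.mem_univ, true_and]
    exact ⟨A τ, hA τ, fun i => rfl⟩
  have hcard := Finset.card_le_mul_card_image_of_maps_to hmaps _ hfib
  have hS := card_realizedLabellings_le hd x
  rw [Fintype.card_prod, Fintype.card_bool] at hS
  calc T.card * 2 ^ m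
      ≤ 2 ^ (Fintype.card I - m) * (realizedLabellings H x).card * 2 ^ m := by gcongr
    _ = (realizedLabellings H x).card * (2 ^ (Fintype.card I - m) * 2 ^ m) := by ring
    _ = (realizedLabellings H x).card * 2 ^ Fintype.card I := by
        rw [← pow_add, Nat.sub_add_cancel hm]
    _ ≤ _ := by gcongr

theorem measurableSet_le_card_filter {Ω I : Type*} [Fintype I] [MeasurableSpace Ω]
    (p : I → Ω → Prop) [∀ i ω, Decidable (p i ω)] (hp : ∀ i, MeasurableSet {ω | p i ω}) (m : ℕ) :
    MeasurableSet {ω | m ≤ (Finset.univ.filter fun i => p i ω).card} := by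
  have h : Measurable fun ω => (Finset.univ.filter fun i => p i ω).card := by
    simp only [Finset.card_filter]
    exact Finset.measurable_sum _ fun i _ => Measurable.ite (hp i) measurable_const measurable_const
  exact measurableSet_le measurable_const h

/-- A learner that is consistent with the target on its sample rarely disagrees with it `m` times on
a second, independent sample. -/
theorem measure_mismatch_le {X I : Type*} [MeasurableSpace X] [Fintype I]
    {H : Set (X → Bool)} {d : ℕ} (hd : classVCDim H ≤ d) (P : I → Measure (X × Bool))
    [∀ i, IsProbabilityMeasure (P i)] {f : X → Bool} (hf : Measurable f)
    {A : (I → X × Bool) → X → Bool} (hA : ∀ c, A c ∈ H)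
    (hAm : Measurable fun p : (I → X × Bool) × X => A p.1 p.2)
    (hAf : ∀ c i, A c (c i).1 = f (c i).1) (m : ℕ) :
    ((Measure.pi P).prod (Measure.pi P))
      {c | m ≤ (Finset.univ.filter fun i => A c.1 (c.2 i).1 ≠ f (c.2 i).1).card} ≤
      ENNReal.ofReal ((2 * Fintype.card I + 1) ^ d / 2 ^ m) := by
  classical
  set μ := (Measure.pi P).prod (Measure.pi P)
  set E := {c : (I → X × Bool) × (I → X × Bool) |
    m ≤ (Finset.univ.filter fun i => A c.1 (c.2 i).1 ≠ f (c.2 i).1).card} with hE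
  have hEm : MeasurableSet E := by
    refine measurableSet_le_card_filter _ (fun i => ?_) m
    have h1 : Measurable fun c : (I → X × Bool) × (I → X × Bool) => A c.1 (c.2 i).1 :=
      hAm.comp (measurable_fst.prodMk
        (measurable_fst.comp ((measurable_pi_apply i).comp measurable_snd)))
    have h2 : Measurable fun c : (I → X × Bool) × (I → X × Bool) => f (c.2 i).1 :=
      hf.comp (measurable_fst.comp ((measurable_pi_apply i).comp measurable_snd))
    exact (measurableSet_eq_fun h1 h2).compl
  -- The law is invariant under exchanges, so the probability can be averaged over them.
  have hsum : (2 : ENNReal) ^ Fintype.card I * μ E =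
      ∫⁻ c, ∑ τ : I → Bool, E.indicator 1 (exchange τ c) ∂μ := by
    have hτ : ∀ τ : I → Bool, ∫⁻ c, E.indicator 1 (exchange τ c) ∂μ = μ E := by
      intro τ
      have hmp := measurePreserving_exchange P τ
      rw [hmp.lintegral_comp (measurable_one.indicator hEm), lintegral_indicator_one hEm]
    have hτm : ∀ τ ∈ (Finset.univ : Finset (I → Bool)),
        Measurable fun c => E.indicator (1 : (I → X × Bool) × (I → X × Bool) → ENNReal)
          (exchange τ c) := fun τ _ =>
      (measurable_one.indicator hEm).comp (measurePreserving_exchange P τ).measurable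
    rw [lintegral_finsetSum _ hτm]
    simp [hτ]
  have hpt : ∀ c, ∑ τ : I → Bool,
      E.indicator (1 : (I → X × Bool) × (I → X × Bool) → ENNReal) (exchange τ c) ≤
      ENNReal.ofReal ((2 * Fintype.card I + 1) ^ d * 2 ^ Fintype.card I / 2 ^ m) := by
    intro c
    have h1 : ∑ τ : I → Bool,
        E.indicator (1 : (I → X × Bool) × (I → X × Bool) → ENNReal) (exchange τ c) =
        ((Finset.univ.filter fun τ : I → Bool => exchange τ c ∈ E).card : ENNReal) := by
      rw [Finset.card_filter]
      push_cast
      refine Finset.sum_congr rfl fun τ _ => ?_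
      simp [Set.indicator_apply]
    have h2 := card_exchange_le hd f (fun p : Bool × I => if p.1 then (c.2 p.2).1 else (c.1 p.2).1)
      (fun τ => A (exchange τ c).1) (fun τ => hA _) m
    have h3 : (Finset.univ.filter fun τ : I → Bool => exchange τ c ∈ E).card * 2 ^ m ≤
        (2 * Fintype.card I + 1) ^ d * 2 ^ Fintype.card I := by
      refine (Nat.mul_le_mul_right _ (Finset.card_le_card fun τ hτ => ?_)).trans h2
      rw [Finset.mem_filter] at hτ ⊢
      refine ⟨Finset.mem_univ _, fun i => ?_, ?_⟩
      · have := hAf (exchange τ c).1 i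
        simp only [exchange] at this ⊢
        split_ifs at this ⊢ <;> exact this
      · refine hτ.2.trans (le_of_eq ?_)
        congr 1
        ext i
        simp only [Finset.mem_filter, Finset.mem_univ, true_and]
        have : ((exchange τ c).2 i).1 = if (!τ i) = true then (c.2 i).1 else (c.1 i).1 := by
          simp only [exchange]
          cases τ i <;> simp
        rw [this]
    rw [h1, ← ENNReal.ofReal_natCast]
    refine ENNReal.ofReal_le_ofReal ?_
    rw [le_div_iff₀ (by positivity)]
    exact_mod_cast h3
  have hle : (2 : ENNReal) ^ Fintype.card I * μ E ≤
      ENNReal.ofReal ((2 * Fintype.card I + 1) ^ d * 2 ^ Fintype.card I / 2 ^ m) := by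
    rw [hsum]
    calc _ ≤ ∫⁻ _, ENNReal.ofReal ((2 * Fintype.card I + 1) ^ d * 2 ^ Fintype.card I / 2 ^ m) ∂μ :=
          lintegral_mono hpt
      _ = _ := by simp [μ]
  have hsplit : ENNReal.ofReal ((2 * Fintype.card I + 1) ^ d * 2 ^ Fintype.card I / 2 ^ m) =
      (2 : ENNReal) ^ Fintype.card I * ENNReal.ofReal ((2 * Fintype.card I + 1) ^ d / 2 ^ m) := by
    rw [show (2 : ENNReal) ^ Fintype.card I = ENNReal.ofReal (2 ^ Fintype.card I) by
      rw [ENNReal.ofReal_pow (by norm_num)]; norm_num, ← ENNReal.ofReal_mul (by positivity)]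
    congr 1; ring
  rw [hsplit] at hle
  exact (ENNReal.mul_le_mul_iff_right (by positivity) (by finiteness)).1 hle

/-! ### One round: learning on a multiset of distributions -/

/-- The expected loss of a deterministic hypothesis. -/
noncomputable def detRisk {X : Type*} [MeasurableSpace X] (ℓ : Bool → X × Bool → ℝ)
    (D : Measure (X × Bool)) (h : X → Bool) : ℝ :=
  ∫ z, ℓ (h z.1) z ∂D

/-- The total loss of a hypothesis on the part of the sample that belongs to the half `e (true, ·)`
of the slots. -/
def halfLoss {X : Type*} (ℓ : Bool → X × Bool → ℝ) {k N : ℕ} (h : X → Bool)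
    (V : (Bool × Fin k) × Fin N → X × Bool) (e : Equiv.Perm (Bool × Fin k)) : ℝ :=
  ∑ p : Fin k × Fin N, ℓ (h (V (e (true, p.1), p.2)).1) (V (e (true, p.1), p.2))

/-- The joint law of independent samples of size `N` from each of the distributions `D u`. -/
noncomputable abbrev sampleLaw {X : Type*} [MeasurableSpace X] {k : ℕ}
    (D : Bool × Fin k → Measure (X × Bool)) (N : ℕ) :
    Measure ((Bool × Fin k) × Fin N → X × Bool) :=
  Measure.pi fun i => D i.1

theorem measurable_loss_comp {X Ω : Type*} [MeasurableSpace X] [MeasurableSpace Ω]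
    {ℓ : Bool → X × Bool → ℝ} (hℓ : ∀ y, Measurable (ℓ y)) {F : Ω → Bool} (hF : Measurable F)
    {w : Ω → X × Bool} (hw : Measurable w) : Measurable fun ω => ℓ (F ω) (w ω) := by
  have h : Measurable fun p : Bool × (X × Bool) => ℓ p.1 p.2 :=
    measurable_from_prod_countable_right hℓ
  exact h.comp (hF.prodMk hw)

theorem measurable_detRisk {X Ω : Type*} [MeasurableSpace X] [MeasurableSpace Ω]
    {ℓ : Bool → X × Bool → ℝ} (hℓ : ∀ y, Measurable (ℓ y)) {F : Ω → X → Bool}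
    (hF : Measurable fun p : Ω × X => F p.1 p.2) (D : Measure (X × Bool))
    [IsProbabilityMeasure D] : Measurable fun ω => detRisk ℓ D (F ω) := by
  have h : Measurable fun p : Ω × (X × Bool) => ℓ (F p.1 p.2.1) p.2 :=
    measurable_loss_comp hℓ (hF.comp (measurable_fst.prodMk (measurable_fst.comp measurable_snd)))
      measurable_snd
  exact (h.stronglyMeasurable.integral_prod_right (ν := D)).measurable

theorem measure_prod_le_of_forall {α β : Type*} [MeasurableSpace α] [MeasurableSpace β]
    {μ : Measure α} {ν : Measure β} [IsProbabilityMeasure μ] [IsProbabilityMeasure ν]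
    {E : Set (α × β)} (hE : MeasurableSet E) {c : ENNReal} (h : ∀ a, ν {b | (a, b) ∈ E} ≤ c) :
    (μ.prod ν) E ≤ c := by
  rw [Measure.prod_apply hE]
  calc _ ≤ ∫⁻ _, c ∂μ := lintegral_mono h
    _ = c := by simp

/-- A measurable consistent learner for samples indexed by an arbitrary finite type. -/
theorem MeasurableClass.exists_selection {X : Type*} [MeasurableSpace X] {H : Set (X → Bool)}
    (hH : MeasurableClass H) (I : Type*) [Finite I] :
    ∃ σ : (I → X × Bool) → X → Bool, (∀ s, σ s ∈ H) ∧
      Measurable (fun p : (I → X × Bool) × X => σ p.1 p.2) ∧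
      ∀ s, (∃ h ∈ H, ∀ j, h (s j).1 = (s j).2) → ∀ j, σ s (s j).1 = (s j).2 := by
  obtain ⟨n, ⟨e⟩⟩ := Finite.exists_equiv_fin I
  obtain ⟨σ, h1, h2, h3⟩ := hH.measurable_selection n
  refine ⟨fun s => σ fun j => s (e.symm j), fun s => h1 _, ?_, ?_⟩
  · have : Measurable fun p : (I → X × Bool) × X => ((fun j => p.1 (e.symm j)), p.2) := by
      refine Measurable.prodMk (measurable_pi_lambda _ fun j => ?_) measurable_snd
      exact (measurable_pi_apply _).comp measurable_fst
    exact h2.comp this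
  · rintro s ⟨h, hh, hs⟩ j
    have := h3 (fun j => s (e.symm j)) ⟨h, hh, fun j => hs _⟩ (e j)
    simpa using this

theorem exists_perm_of_le_card {k : ℕ} (S : Finset (Bool × Fin k)) (hS : k ≤ S.card) :
    ∃ e : Equiv.Perm (Bool × Fin k), ∀ j, e (true, j) ∈ S := by
  classical
  obtain ⟨T, hTS, hT⟩ := Finset.exists_subset_card_eq hS
  have hc : Fintype.card {u : Bool × Fin k // u.1 = true} = Fintype.card {u // u ∈ T} := by
    rw [Fintype.card_coe, hT, Fintype.card_subtype]
    have : (Finset.univ.filter fun u : Bool × Fin k => u.1 = true) =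
        Finset.univ.map ⟨fun j : Fin k => (true, j), fun a b h => by simpa using h⟩ := by
      ext ⟨b, j⟩
      rw [Finset.mem_filter, Finset.mem_map]
      exact ⟨fun h => ⟨j, Finset.mem_univ _, Prod.ext h.2.symm rfl⟩,
        fun ⟨_, _, h⟩ => ⟨Finset.mem_univ _, (congrArg Prod.fst h).symm⟩⟩
    rw [this, Finset.card_map, Finset.card_univ, Fintype.card_fin]
  let f := Fintype.equivOfCardEq hc
  refine ⟨f.extendSubtype, fun j => hTS ?_⟩
  rw [f.extendSubtype_apply_of_mem (true, j) rfl]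
  exact (f _).2

section Deviation

variable {X : Type*} [MeasurableSpace X] {ℓ : Bool → X × Bool → ℝ} {k N : ℕ}
  (D : Bool × Fin k → Measure (X × Bool)) [∀ u, IsProbabilityMeasure (D u)]

theorem halfLoss_deviation (hℓ : ∀ y, Measurable (ℓ y)) (h01 : ∀ y z, ℓ y z ∈ Set.Icc (0 : ℝ) 1)
    (hk : 1 ≤ k) (hN : 1 ≤ N) {h : X → Bool} (hh : Measurable h) (e : Equiv.Perm (Bool × Fin k))
    {ε : ℝ} (hε : 0 ≤ ε) :
    sampleLaw D N {V | ε * (k * N) ≤ halfLoss ℓ h V e - N * ∑ j, detRisk ℓ (D (e (true, j))) h} ≤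
        ENNReal.ofReal (Real.exp (-2 * ε ^ 2 * (k * N))) ∧
    sampleLaw D N {V | ε * (k * N) ≤ N * ∑ j, detRisk ℓ (D (e (true, j))) h - halfLoss ℓ h V e} ≤
        ENNReal.ofReal (Real.exp (-2 * ε ^ 2 * (k * N))) := by
  let g : Fin k × Fin N ↪ (Bool × Fin k) × Fin N :=
    ⟨fun p => (e (true, p.1), p.2), fun p p' h => by
      simp only [Prod.mk.injEq, EmbeddingLike.apply_eq_iff_eq, true_and] at h
      exact Prod.ext h.1 h.2⟩
  have hf : ∀ i : (Bool × Fin k) × Fin N, Measurable fun z : X × Bool => ℓ (h z.1) z := fun _ =>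
    measurable_loss_comp hℓ (hh.comp measurable_fst) measurable_id
  have hf01 : ∀ (i : (Bool × Fin k) × Fin N) (z : X × Bool), ℓ (h z.1) z ∈ Set.Icc (0 : ℝ) 1 :=
    fun _ z => h01 _ z
  have ht : 0 ≤ ε * (k * N) := by positivity
  have h1 := pi_hoeffding (fun i : (Bool × Fin k) × Fin N => D i.1) (fun _ z => ℓ (h z.1) z)
    hf hf01 (Finset.univ.map g) ht
  have h2 := pi_hoeffding_neg (fun i : (Bool × Fin k) × Fin N => D i.1) (fun _ z => ℓ (h z.1) z)
    hf hf01 (Finset.univ.map g) ht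
  have hs : ∑ p : Fin k × Fin N, detRisk ℓ (D (e (true, p.1))) h =
      N * ∑ j, detRisk ℓ (D (e (true, j))) h := by
    rw [Fintype.sum_prod_type, Finset.mul_sum]
    simp
  have hexp : -2 * (ε * (k * N)) ^ 2 / ((k : ℝ) * N) = -2 * ε ^ 2 * (k * N) := by
    have : (k : ℝ) * N ≠ 0 := by positivity
    field_simp
  simp only [Finset.card_map, Finset.card_univ, Fintype.card_prod, Fintype.card_fin, Nat.cast_mul,
    Finset.sum_map, Finset.sum_sub_distrib, hexp] at h1 h2
  rw [← hs]
  exact ⟨h1, h2⟩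

theorem slotLoss_deviation (hℓ : ∀ y, Measurable (ℓ y)) (h01 : ∀ y z, ℓ y z ∈ Set.Icc (0 : ℝ) 1)
    (hN : 1 ≤ N) {h : X → Bool} (hh : Measurable h) (u : Bool × Fin k) {ε : ℝ} (hε : 0 ≤ ε) :
    sampleLaw D N {W | ε * N ≤ |∑ q : Fin N, ℓ (h (W (u, q)).1) (W (u, q)) -
        N * detRisk ℓ (D u) h|} ≤
      ENNReal.ofReal (2 * Real.exp (-2 * ε ^ 2 * N)) := by
  let g : Fin N ↪ (Bool × Fin k) × Fin N :=
    ⟨fun q => (u, q), fun p p' h => by simpa using h⟩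
  have hf : ∀ i : (Bool × Fin k) × Fin N, Measurable fun z : X × Bool => ℓ (h z.1) z := fun _ =>
    measurable_loss_comp hℓ (hh.comp measurable_fst) measurable_id
  have hf01 : ∀ (i : (Bool × Fin k) × Fin N) (z : X × Bool), ℓ (h z.1) z ∈ Set.Icc (0 : ℝ) 1 :=
    fun _ z => h01 _ z
  have ht : 0 ≤ ε * N := by positivity
  have h1 := pi_hoeffding (fun i : (Bool × Fin k) × Fin N => D i.1) (fun _ z => ℓ (h z.1) z)
    hf hf01 (Finset.univ.map g) ht
  have h2 := pi_hoeffding_neg (fun i : (Bool × Fin k) × Fin N => D i.1) (fun _ z => ℓ (h z.1) z)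
    hf hf01 (Finset.univ.map g) ht
  have hexp : -2 * (ε * N) ^ 2 / (N : ℝ) = -2 * ε ^ 2 * N := by
    have : (N : ℝ) ≠ 0 := by positivity
    field_simp
  have hs : ∑ _q : Fin N, ∫ z, ℓ (h z.1) z ∂D u = N * detRisk ℓ (D u) h := by
    simp [detRisk]
  simp only [Finset.card_map, Finset.card_univ, Fintype.card_fin,
    Finset.sum_map, Finset.sum_sub_distrib, hexp] at h1 h2
  rw [two_mul, ENNReal.ofReal_add (by positivity) (by positivity)]
  refine (measure_mono ?_).trans ((measure_union_le _ _).trans (add_le_add h1 h2))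
  intro W hW
  simp only [Set.mem_ofPred_eq, le_abs, neg_sub] at hW
  rw [← hs] at hW
  exact hW

end Deviation

/-- The training part of a round. Unless an unlikely event occurs, on every half `e (true, ·)` of
the slots some expected loss of the hypothesis is at most `M + 3 * ε`, where `M` bounds the expected
losses of some hypothesis of the class on all slots. -/
theorem exists_trained_hypothesis {X : Type*} [MeasurableSpace X] {H : Set (X → Bool)} {d : ℕ}
    {ℓ : Bool → X × Bool → ℝ} (hne : H.Nonempty) (hH : MeasurableClass H)
    (hd : classVCDim H ≤ d) (hℓ : ∀ y, Measurable (ℓ y))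
    (h01 : ∀ y z, ℓ y z ∈ Set.Icc (0 : ℝ) 1) {k : ℕ} (hk : 1 ≤ k) (N : ℕ) :
    ∃ hyp : ((Bool × Fin k) × Fin N → X × Bool) × ((Bool × Fin k) × Fin N → X × Bool) → X → Bool,
      (∀ c, hyp c ∈ H) ∧ Measurable (fun p : _ × X => hyp p.1 p.2) ∧
      (1 ≤ N → ∀ (D : Bool × Fin k → Measure (X × Bool)) [∀ u, IsProbabilityMeasure (D u)],
        ∀ f ∈ H, ∀ M, (∀ u, detRisk ℓ (D u) f ≤ M) → ∀ ε, 0 < ε → ε ≤ 1 / 3 →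
          ((sampleLaw D N).prod (sampleLaw D N))
            {c | ∃ e : Equiv.Perm (Bool × Fin k), ∀ j,
              M + 3 * ε < detRisk ℓ (D (e (true, j))) (hyp c)} ≤
            ENNReal.ofReal (3 * ((4 * k * N + 1) ^ d * (2 * k).factorial *
              Real.exp (-2 * ε ^ 2 * (k * N))))) := by
  classical
  obtain ⟨σ, hσH, hσm, hσc⟩ := hH.exists_selection ((Bool × Fin k) × Fin N)
  let cand (C : (Bool × Fin k) × Fin N → X × Bool) (b : (Bool × Fin k) × Fin N → Bool) : X → Bool :=
    σ fun i => ((C i).1, b i)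
  have hfst : ∀ i, Measurable fun C : (Bool × Fin k) × Fin N → X × Bool => (C i).1 := fun i =>
    measurable_fst.comp (measurable_pi_apply i)
  have hcm : ∀ b, Measurable fun p : ((Bool × Fin k) × Fin N → X × Bool) × X =>
      cand p.1 b p.2 := by
    intro b
    refine hσm.comp (Measurable.prodMk (measurable_pi_lambda _ fun i => ?_) measurable_snd)
    exact ((hfst i).comp measurable_fst).prodMk measurable_const
  let cons (b : (Bool × Fin k) × Fin N → Bool) (C : (Bool × Fin k) × Fin N → X × Bool) : Prop :=
    ∀ i, cand C b (C i).1 = b i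
  have hconsm : ∀ b, MeasurableSet {C | cons b C} := by
    intro b
    have : {C | cons b C} = ⋂ i, {C | cand C b (C i).1 = b i} := by ext; simp [cons]
    rw [this]
    refine MeasurableSet.iInter fun i => measurableSet_eq_fun ?_ measurable_const
    exact (hcm b).comp (measurable_id.prodMk (hfst i))
  -- The labels given by a hypothesis of the class yield a consistent candidate.
  have hcons_of_mem : ∀ h ∈ H, ∀ C, cons (fun i => h (C i).1) C := fun h hh C =>
    hσc (fun i => ((C i).1, h (C i).1)) ⟨h, hh, fun i => rfl⟩
  have hhalfm : ∀ b e, Measurable fun c : ((Bool × Fin k) × Fin N → X × Bool) ×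
      ((Bool × Fin k) × Fin N → X × Bool) => halfLoss ℓ (cand c.1 b) c.2 e := by
    intro b e
    refine Finset.measurable_sum _ fun p _ => measurable_loss_comp hℓ ?_ ?_
    · exact (hcm b).comp (measurable_fst.prodMk ((hfst _).comp measurable_snd))
    · exact (measurable_pi_apply _).comp measurable_snd
  have hhalf_le : ∀ h (V : (Bool × Fin k) × Fin N → X × Bool) e,
      halfLoss ℓ h V e ≤ k * N := by
    intro h V e
    calc halfLoss ℓ h V e ≤ ∑ _p : Fin k × Fin N, (1 : ℝ) :=
          Finset.sum_le_sum fun p _ => (h01 _ _).2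
      _ = k * N := by simp
  -- Inconsistent labellings get a cost that exceeds every training loss.
  let worst (h : X → Bool) (V : (Bool × Fin k) × Fin N → X × Bool) : ℝ := ⨆ e, halfLoss ℓ h V e
  have hworst : ∀ h V e, halfLoss ℓ h V e ≤ worst h V := fun h V e =>
    le_ciSup (f := fun e => halfLoss ℓ h V e) (Set.finite_range _).bddAbove e
  let cost (b : (Bool × Fin k) × Fin N → Bool) (c : ((Bool × Fin k) × Fin N → X × Bool) ×
      ((Bool × Fin k) × Fin N → X × Bool)) : ℝ :=
    if cons b c.1 then worst (cand c.1 b) c.2 else k * N + 1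
  obtain ⟨bh, hbhm, hbh⟩ := exists_measurable_argmin cost fun b =>
    Measurable.ite (measurable_fst (hconsm b)) (Measurable.iSup fun e => hhalfm b e)
      measurable_const
  have hbh_cons : ∀ c, cons (bh c) c.1 := by
    intro c
    by_contra hcon
    obtain ⟨h, hh⟩ := hne
    have h1 := hbh c (fun i => h (c.1 i).1)
    simp only [cost, if_neg hcon, if_pos (hcons_of_mem h hh c.1)] at h1
    have h2 : worst (cand c.1 fun i => h (c.1 i).1) c.2 ≤ k * N := ciSup_le fun e => hhalf_le _ _ e
    linarith
  have hbh_min : ∀ c b, cons b c.1 → worst (cand c.1 (bh c)) c.2 ≤ worst (cand c.1 b) c.2 := by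
    intro c b hb
    have h1 := hbh c b
    simpa only [cost, if_pos (hbh_cons c), if_pos hb] using h1
  have hbh_meas : Measurable bh := measurable_to_countable' fun b => hbhm b
  refine ⟨fun c => cand c.1 (bh c), fun c => hσH _, ?_, ?_⟩
  · refine hσm.comp (Measurable.prodMk (measurable_pi_lambda _ fun i => ?_) measurable_snd)
    exact ((hfst i).comp (measurable_fst.comp measurable_fst)).prodMk
      ((measurable_pi_apply i).comp (hbh_meas.comp measurable_fst))
  intro hN D _ f hf M hM ε hε hε3
  have hkN : (0 : ℝ) < k * N := by positivity
  have hN0 : (0 : ℝ) < N := by positivity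
  have hfm := hH.measurable_mem f hf
  set B := (4 * k * N + 1 : ℝ) ^ d * (2 * k).factorial * Real.exp (-2 * ε ^ 2 * (k * N)) with hB
  have hfac : (1 : ℝ) ≤ (2 * k).factorial := by exact_mod_cast Nat.factorial_pos _
  have hpow : (1 : ℝ) ≤ (4 * k * N + 1) ^ d := one_le_pow₀ (by nlinarith)
  have hcardI : (Fintype.card ((Bool × Fin k) × Fin N) : ℝ) = 2 * k * N := by simp
  -- The candidate that agrees with `f` on the cover nearly agrees with `f` on the training sample.
  set m := ⌈ε * (k * N)⌉₊
  let E₁ : Set (((Bool × Fin k) × Fin N → X × Bool) × ((Bool × Fin k) × Fin N → X × Bool)) :=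
    {c | m ≤ (Finset.univ.filter fun i =>
      cand c.1 (fun i => f (c.1 i).1) (c.2 i).1 ≠ f (c.2 i).1).card}
  have hE₁ : ((sampleLaw D N).prod (sampleLaw D N)) E₁ ≤ ENNReal.ofReal B := by
    have hAm : Measurable fun p : ((Bool × Fin k) × Fin N → X × Bool) × X =>
        cand p.1 (fun i => f (p.1 i).1) p.2 := by
      refine hσm.comp (Measurable.prodMk (measurable_pi_lambda _ fun i => ?_) measurable_snd)
      exact ((hfst i).comp measurable_fst).prodMk (hfm.comp ((hfst i).comp measurable_fst))
    refine (measure_mismatch_le hd (fun i : (Bool × Fin k) × Fin N => D i.1) hfm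
      (A := fun C => cand C fun i => f (C i).1) (fun C => hσH _) hAm
      (fun C i => hcons_of_mem f hf C i) m).trans (ENNReal.ofReal_le_ofReal ?_)
    rw [hcardI, show (2 * (2 * k * N) + 1 : ℝ) = 4 * k * N + 1 by ring, div_eq_mul_inv]
    have h2m : ((2 : ℝ) ^ m)⁻¹ ≤ Real.exp (-2 * ε ^ 2 * (k * N)) := by
      have h1 : (2 : ℝ) ^ m = Real.exp (m * Real.log 2) := by
        rw [mul_comm, Real.exp_mul, Real.exp_log (by norm_num), Real.rpow_natCast]
      rw [h1, ← Real.exp_neg, Real.exp_le_exp]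
      have h2 : ε * (k * N) ≤ m := Nat.le_ceil _
      have h3 := Real.log_two_gt_d9
      have h4 : ε * (k * N) * Real.log 2 ≤ m * Real.log 2 := by gcongr
      have h5 : ε * (2 * ε) * (k * N) ≤ ε * Real.log 2 * (k * N) := by
        gcongr; linarith
      nlinarith
    calc _ ≤ (4 * k * N + 1 : ℝ) ^ d * Real.exp (-2 * ε ^ 2 * (k * N)) := by gcongr
      _ ≤ (4 * k * N + 1 : ℝ) ^ d * (2 * k).factorial * Real.exp (-2 * ε ^ 2 * (k * N)) := by
        gcongr
        exact le_mul_of_one_le_right (by positivity) hfac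
  -- The training loss of `f` is close to its expectation.
  let E₂ : Set ((Bool × Fin k) × Fin N → X × Bool) :=
    ⋃ e : Equiv.Perm (Bool × Fin k),
      {V | ε * (k * N) ≤ halfLoss ℓ f V e - N * ∑ j, detRisk ℓ (D (e (true, j))) f}
  have hperm : Fintype.card (Equiv.Perm (Bool × Fin k)) = (2 * k).factorial := by
    rw [Fintype.card_perm]; simp
  have hE₂ : ((sampleLaw D N).prod (sampleLaw D N)) (Prod.snd ⁻¹' E₂) ≤ ENNReal.ofReal B := by
    rw [← Set.univ_prod, Measure.prod_prod, measure_univ, one_mul]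
    refine (measure_iUnion_fintype_le _ _).trans ((Finset.sum_le_sum fun e _ =>
      (halfLoss_deviation D hℓ h01 hk hN hfm e hε.le).1).trans ?_)
    rw [Finset.sum_const, Finset.card_univ, hperm, nsmul_eq_mul, ← ENNReal.ofReal_natCast,
      ← ENNReal.ofReal_mul (by positivity)]
    refine ENNReal.ofReal_le_ofReal ?_
    rw [hB, mul_assoc ((4 * k * N + 1 : ℝ) ^ d)]
    exact le_mul_of_one_le_left (by positivity) hpow
  -- The expected losses of all the candidates are at most their training losses.
  let E₃ : Set (((Bool × Fin k) × Fin N → X × Bool) × ((Bool × Fin k) × Fin N → X × Bool)) :=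
    ⋃ (b) (e : Equiv.Perm (Bool × Fin k)), {c | cons b c.1 ∧
      ε * (k * N) ≤ N * ∑ j, detRisk ℓ (D (e (true, j))) (cand c.1 b) -
        halfLoss ℓ (cand c.1 b) c.2 e}
  have hE₃m : MeasurableSet E₃ := by
    refine MeasurableSet.iUnion fun b => MeasurableSet.iUnion fun e => ?_
    rw [Set.ofPred_and]
    refine (measurable_fst (hconsm b)).inter (measurableSet_le measurable_const ?_)
    refine Measurable.sub (Measurable.const_mul (Finset.measurable_sum _ fun j _ => ?_) _)
      (hhalfm b e)
    exact (measurable_detRisk hℓ (F := fun C => cand C b) (hcm b) _).comp measurable_fst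
  have hE₃ : ((sampleLaw D N).prod (sampleLaw D N)) E₃ ≤ ENNReal.ofReal B := by
    refine measure_prod_le_of_forall hE₃m fun C => ?_
    have hsub : {V | (C, V) ∈ E₃} ⊆ ⋃ p ∈ (realizedLabellings H (fun i => (C i).1)) ×ˢ
        (Finset.univ : Finset (Equiv.Perm (Bool × Fin k))),
        {V | ε * (k * N) ≤ N * ∑ j, detRisk ℓ (D (p.2 (true, j))) (cand C p.1) -
          halfLoss ℓ (cand C p.1) V p.2} := by
      intro V hV
      simp only [E₃, Set.mem_ofPred_eq, Set.mem_iUnion] at hV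
      obtain ⟨b, e, hb, hV⟩ := hV
      simp only [Set.mem_iUnion, Finset.mem_product, Finset.mem_univ, and_true]
      refine ⟨(b, e), ?_, hV⟩
      simp only [realizedLabellings, Finset.mem_filter, Finset.mem_univ, true_and]
      exact ⟨cand C b, hσH _, hb⟩
    refine (measure_mono hsub).trans ((measure_biUnion_finset_le _ _).trans
      ((Finset.sum_le_sum fun p _ => (halfLoss_deviation D hℓ h01 hk hN
        (hH.measurable_mem _ (hσH _)) p.2 hε.le).2).trans ?_))
    rw [Finset.sum_const, Finset.card_product, Finset.card_univ, hperm, nsmul_eq_mul,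
      ← ENNReal.ofReal_natCast, ← ENNReal.ofReal_mul (by positivity)]
    refine ENNReal.ofReal_le_ofReal ?_
    have h1 : ((realizedLabellings H fun i => (C i).1).card : ℝ) ≤ (4 * k * N + 1) ^ d := by
      have h2 := card_realizedLabellings_le hd fun i => (C i).1
      have h3 : ((realizedLabellings H fun i => (C i).1).card : ℝ) ≤
        (Fintype.card ((Bool × Fin k) × Fin N) + 1) ^ d := by exact_mod_cast h2
      rw [hcardI] at h3
      refine h3.trans ?_
      gcongr
      norm_num
    rw [hB]
    push_cast
    gcongr
  have hsub : {c | ∃ e : Equiv.Perm (Bool × Fin k), ∀ j,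
      M + 3 * ε < detRisk ℓ (D (e (true, j))) (cand c.1 (bh c))} ⊆
      (E₁ ∪ Prod.snd ⁻¹' E₂) ∪ E₃ := by
    intro c hc
    by_contra hnot
    simp only [Set.mem_union, not_or] at hnot
    obtain ⟨⟨hn1, hn2⟩, hn3⟩ := hnot
    simp only [E₂, E₃, Set.mem_preimage, Set.mem_iUnion, Set.mem_ofPred_eq, not_exists, not_le,
      not_and] at hn2 hn3
    obtain ⟨e, he⟩ := hc
    have hk0 : (Finset.univ : Finset (Fin k)).Nonempty := ⟨⟨0, hk⟩, Finset.mem_univ _⟩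
    have hlow : (k : ℝ) * (M + 3 * ε) < ∑ j, detRisk ℓ (D (e (true, j))) (cand c.1 (bh c)) := by
      calc (k : ℝ) * (M + 3 * ε) = ∑ _j : Fin k, (M + 3 * ε) := by
            rw [Finset.sum_const, Finset.card_univ, Fintype.card_fin, nsmul_eq_mul]
        _ < _ := Finset.sum_lt_sum_of_nonempty hk0 fun j _ => he j
    have h3 := hn3 _ e (hbh_cons c)
    have h4 := (hworst (cand c.1 (bh c)) c.2 e).trans (hbh_min c _ (hcons_of_mem f hf c.1))
    obtain ⟨e', he'⟩ := exists_eq_ciSup_of_finite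
      (f := fun e => halfLoss ℓ (cand c.1 fun i => f (c.1 i).1) c.2 e)
    have h5 : halfLoss ℓ (cand c.1 fun i => f (c.1 i).1) c.2 e' ≤
        halfLoss ℓ f c.2 e' + ε * (k * N) := by
      have hcount : (((Finset.univ.filter fun i =>
          cand c.1 (fun i => f (c.1 i).1) (c.2 i).1 ≠ f (c.2 i).1).card : ℕ) : ℝ) <
          ε * (k * N) := Nat.lt_ceil.1 (not_le.1 hn1)
      have hdiff : ∀ i, ℓ (cand c.1 (fun i => f (c.1 i).1) (c.2 i).1) (c.2 i) ≤
          ℓ (f (c.2 i).1) (c.2 i) +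
          if cand c.1 (fun i => f (c.1 i).1) (c.2 i).1 ≠ f (c.2 i).1 then 1 else 0 := by
        intro i
        split_ifs with h
        · linarith [(h01 (cand c.1 (fun i => f (c.1 i).1) (c.2 i).1) (c.2 i)).2,
            (h01 (f (c.2 i).1) (c.2 i)).1]
        · rw [not_not.1 h]; simp
      have hinj : Function.Injective fun p : Fin k × Fin N => (e' (true, p.1), p.2) := by
        intro p p' h
        simp only [Prod.mk.injEq, EmbeddingLike.apply_eq_iff_eq, true_and] at h
        exact Prod.ext h.1 h.2
      calc halfLoss ℓ (cand c.1 fun i => f (c.1 i).1) c.2 e'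
          ≤ ∑ p : Fin k × Fin N, (ℓ (f (c.2 (e' (true, p.1), p.2)).1) (c.2 (e' (true, p.1), p.2)) +
            if cand c.1 (fun i => f (c.1 i).1) (c.2 (e' (true, p.1), p.2)).1 ≠
              f (c.2 (e' (true, p.1), p.2)).1 then 1 else 0) :=
            Finset.sum_le_sum fun p _ => hdiff _
        _ = halfLoss ℓ f c.2 e' + ∑ i ∈ Finset.univ.map ⟨_, hinj⟩,
            (if cand c.1 (fun i => f (c.1 i).1) (c.2 i).1 ≠ f (c.2 i).1 then (1 : ℝ) else 0) := by
            rw [Finset.sum_add_distrib, Finset.sum_map]; rfl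
        _ ≤ halfLoss ℓ f c.2 e' + ∑ i,
            (if cand c.1 (fun i => f (c.1 i).1) (c.2 i).1 ≠ f (c.2 i).1 then (1 : ℝ) else 0) := by
            refine add_le_add le_rfl ?_
            exact Finset.sum_le_sum_of_subset_of_nonneg (Finset.subset_univ _)
              fun i _ _ => by split_ifs <;> norm_num
        _ ≤ _ := by
            rw [Finset.sum_boole]
            linarith
    have h6 := hn2 e'
    have h7 : ∑ j, detRisk ℓ (D (e' (true, j))) f ≤ k * M := by
      calc _ ≤ ∑ _j : Fin k, M := Finset.sum_le_sum fun j _ => hM _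
        _ = k * M := by simp
    have h8 : halfLoss ℓ (cand c.1 (bh c)) c.2 e ≤
        halfLoss ℓ (cand c.1 fun i => f (c.1 i).1) c.2 e' := h4.trans he'.ge
    have h9 := mul_lt_mul_of_pos_left hlow hN0
    have h10 := mul_le_mul_of_nonneg_left h7 hN0.le
    nlinarith
  calc _ ≤ ((sampleLaw D N).prod (sampleLaw D N)) ((E₁ ∪ Prod.snd ⁻¹' E₂) ∪ E₃) :=
        measure_mono hsub
    _ ≤ ENNReal.ofReal B + ENNReal.ofReal B + ENNReal.ofReal B :=
        (measure_union_le _ _).trans (add_le_add ((measure_union_le _ _).trans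
          (add_le_add hE₁ hE₂)) hE₃)
    _ = _ := by
        have : 0 ≤ B := by positivity
        rw [← ENNReal.ofReal_add this this, ← ENNReal.ofReal_add (by positivity) this]
        congr 1; ring

/-- One round of the algorithm. From three samples of size `N` for each of the `2 * k` slots the
learner computes a hypothesis of the class and a permutation of the slots whose `true` half consists
of slots on which the hypothesis does nearly as well as any single hypothesis does on all. -/
theorem exists_round {X : Type*} [MeasurableSpace X] {H : Set (X → Bool)} {d : ℕ}
    {ℓ : Bool → X × Bool → ℝ} (hne : H.Nonempty) (hH : MeasurableClass H)
    (hd : classVCDim H ≤ d) (hℓ : ∀ y, Measurable (ℓ y))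
    (h01 : ∀ y z, ℓ y z ∈ Set.Icc (0 : ℝ) 1) {k : ℕ} (hk : 1 ≤ k) (N : ℕ) :
    ∃ (hyp : (((Bool × Fin k) × Fin N → X × Bool) × ((Bool × Fin k) × Fin N → X × Bool)) ×
          ((Bool × Fin k) × Fin N → X × Bool) → X → Bool)
      (sel : (((Bool × Fin k) × Fin N → X × Bool) × ((Bool × Fin k) × Fin N → X × Bool)) ×
          ((Bool × Fin k) × Fin N → X × Bool) → Equiv.Perm (Bool × Fin k)),
      (∀ c, hyp c ∈ H) ∧ (∀ e, MeasurableSet {c | sel c = e}) ∧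
      (1 ≤ N → ∀ (D : Bool × Fin k → Measure (X × Bool)) [∀ u, IsProbabilityMeasure (D u)],
        ∀ f ∈ H, ∀ M, (∀ u, detRisk ℓ (D u) f ≤ M) → ∀ ε, 0 < ε → ε ≤ 1 / 3 →
          (((sampleLaw D N).prod (sampleLaw D N)).prod (sampleLaw D N))
            {c | ∃ j, M + 5 * ε < detRisk ℓ (D (sel c (true, j))) (hyp c)} ≤
            ENNReal.ofReal (3 * ((4 * k * N + 1) ^ d * (2 * k).factorial *
              Real.exp (-2 * ε ^ 2 * (k * N))) + 4 * k * Real.exp (-2 * ε ^ 2 * N))) := by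
  classical
  obtain ⟨hyp, hypH, hypm, htrain⟩ := exists_trained_hypothesis hne hH hd hℓ h01 hk N
  let test (u : Bool × Fin k) (c : (((Bool × Fin k) × Fin N → X × Bool) ×
      ((Bool × Fin k) × Fin N → X × Bool)) × ((Bool × Fin k) × Fin N → X × Bool)) : ℝ :=
    ∑ q : Fin N, ℓ (hyp c.1 (c.2 (u, q)).1) (c.2 (u, q))
  have htestm : ∀ u, Measurable (test u) := by
    intro u
    have h1 : ∀ q : Fin N, Measurable fun c : (((Bool × Fin k) × Fin N → X × Bool) ×
      ((Bool × Fin k) × Fin N → X × Bool)) × ((Bool × Fin k) × Fin N → X × Bool) => c.2 (u, q) :=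
      fun q => (measurable_pi_apply _).comp measurable_snd
    exact Finset.measurable_sum _ fun q _ => measurable_loss_comp hℓ
      (hypm.comp (measurable_fst.prodMk (measurable_fst.comp (h1 q)))) (h1 q)
  obtain ⟨sel, hselm, hsel⟩ := exists_measurable_argmin
    (fun (e : Equiv.Perm (Bool × Fin k)) c => ⨆ j, test (e (true, j)) c)
    fun e => Measurable.iSup fun j => htestm _
  refine ⟨fun c => hyp c.1, sel, fun c => hypH _, hselm, ?_⟩
  intro hN D _ f hf M hM ε hε hε3
  have hN0 : (0 : ℝ) < N := by positivity
  let E₁ : Set (((Bool × Fin k) × Fin N → X × Bool) × ((Bool × Fin k) × Fin N → X × Bool)) :=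
    {c | ∃ e : Equiv.Perm (Bool × Fin k), ∀ j,
      M + 3 * ε < detRisk ℓ (D (e (true, j))) (hyp c)}
  let E₂ : Set ((((Bool × Fin k) × Fin N → X × Bool) × ((Bool × Fin k) × Fin N → X × Bool)) ×
      ((Bool × Fin k) × Fin N → X × Bool)) :=
    ⋃ u, {c | ε * N ≤ |test u c - N * detRisk ℓ (D u) (hyp c.1)|}
  have hE₁ : (((sampleLaw D N).prod (sampleLaw D N)).prod (sampleLaw D N)) (Prod.fst ⁻¹' E₁) ≤
      ENNReal.ofReal (3 * ((4 * k * N + 1) ^ d * (2 * k).factorial *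
              Real.exp (-2 * ε ^ 2 * (k * N)))) := by
    rw [← Set.prod_univ, Measure.prod_prod, measure_univ, mul_one]
    exact htrain hN D f hf M hM ε hε hε3
  have hE₂m : MeasurableSet E₂ := by
    refine MeasurableSet.iUnion fun u => measurableSet_le measurable_const ?_
    exact continuous_abs.measurable.comp ((htestm u).sub
      (((measurable_detRisk hℓ hypm (D u)).comp measurable_fst).const_mul _))
  have hE₂ : (((sampleLaw D N).prod (sampleLaw D N)).prod (sampleLaw D N)) E₂ ≤
      ENNReal.ofReal (4 * k * Real.exp (-2 * ε ^ 2 * N)) := by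
    refine measure_prod_le_of_forall hE₂m fun c => ?_
    have hs : {W | (c, W) ∈ E₂} = ⋃ u, {W | ε * N ≤ |∑ q : Fin N,
        ℓ (hyp c (W (u, q)).1) (W (u, q)) - N * detRisk ℓ (D u) (hyp c)|} := by
      ext W; simp [E₂, test]
    rw [hs]
    refine (measure_iUnion_fintype_le _ _).trans ((Finset.sum_le_sum fun u _ =>
      slotLoss_deviation D hℓ h01 hN (hH.measurable_mem _ (hypH c)) u hε.le).trans ?_)
    rw [Finset.sum_const, Finset.card_univ, nsmul_eq_mul, ← ENNReal.ofReal_natCast,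
      ← ENNReal.ofReal_mul (by positivity)]
    refine ENNReal.ofReal_le_ofReal (le_of_eq ?_)
    simp only [Fintype.card_prod, Fintype.card_bool, Fintype.card_fin]
    push_cast
    ring
  have hsub : {c | ∃ j, M + 5 * ε < detRisk ℓ (D (sel c (true, j))) (hyp c.1)} ⊆
      Prod.fst ⁻¹' E₁ ∪ E₂ := by
    intro c hc
    by_contra hnot
    simp only [Set.mem_union, not_or] at hnot
    obtain ⟨hn1, hn2⟩ := hnot
    simp only [E₁, E₂, Set.mem_preimage, Set.mem_iUnion, Set.mem_ofPred_eq, not_exists, not_le,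
      not_forall, not_lt] at hn1 hn2
    obtain ⟨j, hj⟩ := hc
    -- Fewer than half of the slots have a large expected loss.
    have hbad : (Finset.univ.filter fun u => M + 3 * ε < detRisk ℓ (D u) (hyp c.1)).card < k := by
      by_contra hge
      obtain ⟨e, he⟩ := exists_perm_of_le_card _ (not_lt.1 hge)
      obtain ⟨j, hj⟩ := hn1 e
      have := (Finset.mem_filter.1 (he j)).2
      linarith
    have hgood : k ≤ (Finset.univ.filter fun u =>
        ¬ M + 3 * ε < detRisk ℓ (D u) (hyp c.1)).card := by
      have := Finset.card_filter_add_card_filter_not (s := (Finset.univ : Finset (Bool × Fin k)))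
        (fun u => M + 3 * ε < detRisk ℓ (D u) (hyp c.1))
      simp only [Finset.card_univ, Fintype.card_prod, Fintype.card_bool, Fintype.card_fin] at this
      omega
    obtain ⟨e, he⟩ := exists_perm_of_le_card _ hgood
    have : Nonempty (Fin k) := ⟨⟨0, hk⟩⟩
    have h1 : ⨆ j, test (e (true, j)) c ≤ N * (M + 4 * ε) := by
      refine ciSup_le fun j => ?_
      have h2 := (abs_lt.1 (hn2 (e (true, j)))).2
      have h3 := not_lt.1 (Finset.mem_filter.1 (he j)).2
      have h4 := mul_le_mul_of_nonneg_left h3 hN0.le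
      nlinarith
    have h2 : test (sel c (true, j)) c ≤ ⨆ j, test (sel c (true, j)) c :=
      le_ciSup (f := fun j => test (sel c (true, j)) c) (Set.finite_range _).bddAbove j
    have h3 := hsel c e
    have h4 := (abs_lt.1 (hn2 (sel c (true, j)))).1
    have h5 := mul_lt_mul_of_pos_left hj hN0
    nlinarith
  calc _ ≤ _ := measure_mono hsub
    _ ≤ _ := (measure_union_le _ _).trans (add_le_add hE₁ hE₂)
    _ = _ := by rw [← ENNReal.ofReal_add (by positivity) (by positivity)]

/-! ### Adaptive sampling from a product measure -/

/-- If `f` depends only on the coordinates in `p` and each event `B a` only on the others, then the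
event `B (f ω)` is at most as likely as the likeliest of the events `B a`. The `B a` need not be
measurable. -/
theorem measure_mem_of_depends_le {ι E α : Type*} [Fintype ι] [MeasurableSpace E] [Fintype α]
    (ν : ι → Measure E) [∀ i, IsProbabilityMeasure (ν i)] (p : ι → Prop) (f : (ι → E) → α)
    (hf : ∀ ω ω', (∀ i, p i → ω i = ω' i) → f ω = f ω') (hfm : ∀ a, MeasurableSet {ω | f ω = a})
    (B : α → Set (ι → E)) (hB : ∀ a ω ω', (∀ i, ¬ p i → ω i = ω' i) → ω ∈ B a → ω' ∈ B a)
    {c : ENNReal} (hc : ∀ a, Measure.pi ν (B a) ≤ c) :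
    Measure.pi ν {ω | ω ∈ B (f ω)} ≤ c := by
  classical
  have hmp := measurePreserving_piEquivPiSubtypeProd ν p
  set e := MeasurableEquiv.piEquivPiSubtypeProd (fun _ : ι => E) p
  have key : ∀ a, Measure.pi ν ({ω | f ω = a} ∩ B a) = Measure.pi ν {ω | f ω = a} *
      Measure.pi ν (B a) := by
    intro a
    let S := {x | ∃ ω, f ω = a ∧ (e ω).1 = x}
    let T := {y | ∃ ω ∈ B a, (e ω).2 = y}
    have hS : {ω | f ω = a} = e ⁻¹' (S ×ˢ Set.univ) := by
      ext ω
      constructor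
      · intro h; exact ⟨⟨ω, h, rfl⟩, trivial⟩
      · rintro ⟨⟨ω', h, h'⟩, -⟩
        have : f ω = f ω' := hf _ _ fun i hi => (congrFun h' ⟨i, hi⟩).symm
        exact this.trans h
    have hT : B a = e ⁻¹' (Set.univ ×ˢ T) := by
      ext ω
      constructor
      · intro h; exact ⟨trivial, ⟨ω, h, rfl⟩⟩
      · rintro ⟨-, ⟨ω', h, h'⟩⟩
        exact hB a ω' ω (fun i hi => congrFun h' ⟨i, hi⟩) h
    have hST : {ω | f ω = a} ∩ B a = e ⁻¹' (S ×ˢ T) := by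
      rw [hS, hT, ← Set.preimage_inter, Set.prod_inter_prod, Set.inter_univ, Set.univ_inter]
    rw [hST, hS, hT, hmp.measure_preimage_equiv, hmp.measure_preimage_equiv,
      hmp.measure_preimage_equiv, Measure.prod_prod, Measure.prod_prod, Measure.prod_prod]
    simp
  have hsub : {ω | ω ∈ B (f ω)} ⊆ ⋃ a, ({ω | f ω = a} ∩ B a) := fun ω hω =>
    Set.mem_iUnion.2 ⟨f ω, rfl, hω⟩
  have hone : ∑ a, Measure.pi ν {ω | f ω = a} = 1 := by
    have h := measure_iUnion (μ := Measure.pi ν) (f := fun a => {ω | f ω = a})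
      (fun a b hab => Set.disjoint_left.2 fun ω ha hb => hab (ha.symm.trans hb)) hfm
    rw [tsum_fintype] at h
    rw [← h]
    have : ⋃ a, {ω | f ω = a} = Set.univ := by ext; simp
    rw [this, measure_univ]
  calc _ ≤ _ := measure_mono hsub
    _ ≤ ∑ a, Measure.pi ν ({ω | f ω = a} ∩ B a) := measure_iUnion_fintype_le _ _
    _ ≤ ∑ a, Measure.pi ν {ω | f ω = a} * c := by
        refine Finset.sum_le_sum fun a _ => ?_
        rw [key]
        gcongr
        exact hc a
    _ = c := by rw [← Finset.sum_mul, hone, one_mul]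

/-- The coordinates `a s` of the entries `τ s` of independent copies of `Measure.pi D`, for distinct
`τ s`, are independent with laws `D (a s)`. -/
theorem measure_pi_select_le {ι κ J E : Type*} [Fintype ι] [Fintype κ] [Fintype J]
    [MeasurableSpace E] (D : κ → Measure E) [∀ i, IsProbabilityMeasure (D i)] {τ : J → ι}
    (hτ : Function.Injective τ) (a : J → κ) (B : Set (J → E)) :
    (Measure.pi fun _ : ι => Measure.pi D) {ω | (fun s => ω (τ s) (a s)) ∈ B} ≤
      (Measure.pi fun s => D (a s)) B := by
  have h0 : ProbabilityTheory.iIndepFun (fun (i : ι) (ω : ι → κ → E) => ω i)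
      (Measure.pi fun _ : ι => Measure.pi D) :=
    ProbabilityTheory.iIndepFun_pi (μ := fun _ : ι => Measure.pi D) (X := fun _ => id)
      fun _ => aemeasurable_id
  have h1 := (h0.precomp hτ).comp (fun s (y : κ → E) => y (a s)) fun s => measurable_pi_apply _
  have hm : ∀ s, Measurable fun ω : ι → κ → E => ω (τ s) (a s) := fun s =>
    (measurable_pi_apply _).comp (measurable_pi_apply _)
  have h2 := (ProbabilityTheory.iIndepFun_iff_map_fun_eq_pi_map
    (f := fun (s : J) (ω : ι → κ → E) => ω (τ s) (a s)) fun s => (hm s).aemeasurable).1 h1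
  have h3 : ∀ s, (Measure.pi fun _ : ι => Measure.pi D).map (fun ω => ω (τ s) (a s)) = D (a s) := by
    intro s
    exact ((measurePreserving_eval D (a s)).comp
      (measurePreserving_eval (fun _ : ι => Measure.pi D) (τ s))).map_eq
  simp only [h3] at h2
  rw [← h2]
  exact Measure.le_map_apply (measurable_pi_lambda _ hm).aemeasurable B

/-! ### The schedule of the rounds -/

/-- The positions in the sample of one round: a cover, a training and a test part, each with `N`
examples for each of the `2 * k` slots. -/
abbrev RoundIndex (k N : ℕ) : Type :=
  (((Bool × Fin k) × Fin N) ⊕ ((Bool × Fin k) × Fin N)) ⊕ ((Bool × Fin k) × Fin N)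

/-- The slot that a position in the sample of one round belongs to. -/
def RoundIndex.slot {k N : ℕ} : RoundIndex k N → Bool × Fin k
  | .inl (.inl i) => i.1
  | .inl (.inr i) => i.1
  | .inr i => i.1

/-- What the learner computes from the sample of a round: a hypothesis, and a permutation of the
slots whose `true` half consists of the slots to be retired with that hypothesis. -/
structure RoundRule (X : Type*) [MeasurableSpace X] (k : ℕ) where
  hyp : ∀ N, (RoundIndex k N → X × Bool) → X → Bool
  sel : ∀ N, (RoundIndex k N → X × Bool) → Equiv.Perm (Bool × Fin k)
  measurable_hyp : ∀ N c, Measurable (hyp N c)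
  measurable_sel : ∀ N e, MeasurableSet {c | sel N c = e}

/-- The sample size per slot in the `g`-th round. The rounds come in epochs of `R` rounds, and the
sample size is doubled after each epoch. -/
abbrev roundSize (R g : ℕ) : ℕ := 2 ^ (g / R)

/-- The time at which the `g`-th round starts. -/
def roundStart (k R g : ℕ) : ℕ := ∑ i ∈ Finset.range g, 6 * k * roundSize R i

/-- The time at which a given position of the sample of the `g`-th round is filled. -/
noncomputable def roundTime (k R g : ℕ) (s : RoundIndex k (roundSize R g)) : ℕ :=
  roundStart k R g + Fintype.equivFin _ s

theorem roundStart_le_roundTime (k R g : ℕ) (s : RoundIndex k (roundSize R g)) :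
    roundStart k R g ≤ roundTime k R g s := Nat.le_add_right _ _

theorem roundTime_lt (k R g : ℕ) (s : RoundIndex k (roundSize R g)) :
    roundTime k R g s < roundStart k R (g + 1) := by
  have h := (Fintype.equivFin _ s).isLt
  have hc : Fintype.card (RoundIndex k (roundSize R g)) = 6 * k * roundSize R g := by
    simp only [RoundIndex, Fintype.card_sum, Fintype.card_prod, Fintype.card_bool, Fintype.card_fin]
    ring
  have h2 : roundStart k R (g + 1) = roundStart k R g + 6 * k * roundSize R g :=
    Finset.sum_range_succ _ _
  rw [h2, ← hc]
  exact Nat.add_lt_add_left h _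

theorem roundStart_strictMono (k R : ℕ) [NeZero k] : StrictMono (roundStart k R) := by
  refine strictMono_nat_of_lt_succ fun g => ?_
  have h2 : roundStart k R (g + 1) = roundStart k R g + 6 * k * roundSize R g :=
    Finset.sum_range_succ _ _
  have := NeZero.pos k
  have : 0 < 6 * k * roundSize R g := by positivity
  omega

theorem roundTime_injective (k R : ℕ) [NeZero k] : Function.Injective
    fun p : Σ g, RoundIndex k (roundSize R g) => roundTime k R p.1 p.2 := by
  rintro ⟨g, s⟩ ⟨g', s'⟩ h
  simp only at h
  have hg : g = g' := by
    rcases lt_trichotomy g g' with hlt | heq | hlt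
    · have h1 := roundTime_lt k R g s
      have h2 := (roundStart_strictMono k R).monotone (Nat.succ_le_of_lt hlt)
      have h3 := roundStart_le_roundTime k R g' s'
      simp only [Nat.succ_eq_add_one] at h2
      omega
    · exact heq
    · have h1 := roundTime_lt k R g' s'
      have h2 := (roundStart_strictMono k R).monotone (Nat.succ_le_of_lt hlt)
      have h3 := roundStart_le_roundTime k R g s
      simp only [Nat.succ_eq_add_one] at h2
      omega
  subst hg
  simp only [roundTime, Nat.add_left_cancel_iff, Fin.val_inj, EmbeddingLike.apply_eq_iff_eq] at h
  rw [h]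

namespace RoundRule

/-- The sample of the `g`-th round, read off the sequence of all examples. -/
noncomputable def data {X : Type*} (k : ℕ) (R g : ℕ) (z : ℕ → X × Bool) :
    RoundIndex k (roundSize R g) → X × Bool :=
  fun s => z (roundTime k R g s)

theorem data_congr {X : Type*} {k R g T : ℕ} (hT : roundStart k R (g + 1) ≤ T) {z z' : ℕ → X × Bool}
    (h : ∀ t < T, z t = z' t) : data k R g z = data k R g z' :=
  funext fun s => h _ ((roundTime_lt k R g s).trans_le hT)

variable {X : Type*} [MeasurableSpace X] {k : ℕ} (A : RoundRule X k) (R : ℕ)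

/-- The assignment of distributions to slots in the `g`-th round. An epoch starts with two slots for
each distribution; after each round, each slot that was not retired is doubled. -/
noncomputable def state : ℕ → (ℕ → X × Bool) → Bool × Fin k → Fin k
  | 0, _ => Prod.snd
  | g + 1, z => if (g + 1) % R = 0 then Prod.snd else
      fun u => state g z (A.sel _ (data k R g z) (false, u.2))

/-- The distribution asked for at time `t`. -/
noncomputable def nextQuery [NeZero k] (t : ℕ) (z : ℕ → X × Bool) : Fin k :=
  open Classical in
  if h : ∃ p : Σ g, RoundIndex k (roundSize R g), roundTime k R p.1 p.2 = t then
    A.state R h.choose.1 z h.choose.2.slot else 0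

/-- Distribution `i` loses a slot in the `g`-th round. -/
def Retires (g : ℕ) (z : ℕ → X × Bool) (i : Fin k) : Prop :=
  ∃ j, A.state R g z (A.sel _ (data k R g z) (true, j)) = i

theorem state_congr [NeZero k] {g : ℕ} {z z' : ℕ → X × Bool}
    (h : ∀ t < roundStart k R g, z t = z' t) : A.state R g z = A.state R g z' := by
  induction g with
  | zero => rfl
  | succ g ih =>
    have h1 := ih fun t ht => h t (ht.trans (roundStart_strictMono k R (Nat.lt_succ_self g)))
    have h2 := data_congr (k := k) le_rfl h
    simp only [state, h1, h2]

theorem nextQuery_roundTime [NeZero k] (g : ℕ) (s : RoundIndex k (roundSize R g))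
    (z : ℕ → X × Bool) : A.nextQuery R (roundTime k R g s) z = A.state R g z s.slot := by
  have h : ∃ p : Σ g, RoundIndex k (roundSize R g),
    roundTime k R p.1 p.2 = roundTime k R g s := ⟨⟨g, s⟩, rfl⟩
  have h2 : h.choose = ⟨g, s⟩ := roundTime_injective k R h.choose_spec
  rw [nextQuery, dif_pos h, h2]

theorem nextQuery_congr [NeZero k] {t : ℕ} {z z' : ℕ → X × Bool} (h : ∀ t' < t, z t' = z' t') :
    A.nextQuery R t z = A.nextQuery R t z' := by
  unfold nextQuery
  split_ifs with hp
  · have h2 := hp.choose_spec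
    rw [A.state_congr R fun t' ht' => h t' (ht'.trans_le
      ((roundStart_le_roundTime k R _ hp.choose.2).trans h2.le))]
  · rfl

theorem measurable_data {X : Type*} [MeasurableSpace X] (k R g : ℕ) :
    Measurable (data (X := X) k R g) :=
  measurable_pi_lambda _ fun _ => measurable_pi_apply _

theorem measurable_state (g : ℕ) : Measurable (A.state R g) := by
  induction g with
  | zero => exact measurable_const
  | succ g ih =>
    by_cases h0 : (g + 1) % R = 0
    · have : A.state R (g + 1) = fun _ => Prod.snd := by funext z; simp only [state, if_pos h0]
      rw [this]; exact measurable_const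
    · have : A.state R (g + 1) = fun z u =>
          A.state R g z (A.sel _ (data k R g z) (false, u.2)) := by
        funext z; simp only [state, if_neg h0]
      rw [this]
      refine measurable_pi_lambda _ fun u => measurable_to_countable' fun i => ?_
      have h2 : (fun z => A.state R g z (A.sel _ (data k R g z) (false, u.2))) ⁻¹' {i} =
          ⋃ e, (data k R g ⁻¹' {c | A.sel _ c = e}) ∩ {z | A.state R g z (e (false, u.2)) = i} := by
        ext z; simp
      rw [h2]
      refine MeasurableSet.iUnion fun e => ((measurable_data k R g) (A.measurable_sel _ e)).inter ?_
      exact measurableSet_eq_fun ((measurable_pi_apply _).comp ih) measurable_const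

theorem measurable_nextQuery [NeZero k] (t : ℕ) : Measurable (A.nextQuery R t) := by
  unfold nextQuery
  split_ifs with h
  · exact (measurable_pi_apply _).comp (A.measurable_state R _)
  · exact measurable_const

end RoundRule

/-! ### The learner and its probability of failure -/

theorem risk_pure {X : Type*} [MeasurableSpace X] (ℓ : Bool → X × Bool → ℝ) (D : Measure (X × Bool))
    (h : X → Bool) : risk ℓ D (fun x => PMF.pure (h x)) = detRisk ℓ D h := by
  unfold risk detRisk
  congr 1
  funext z
  rcases hb : h z.1 <;> simp [PMF.pure_apply, hb]

theorem PersonalizedLearner.length_transcript {X : Type*} [MeasurableSpace X] {k : ℕ}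
    (L : PersonalizedLearner X k) :
    ∀ (m : ℕ) (ω : Fin m → Fin k → X × Bool), (L.transcript m ω).length = m
  | 0, _ => rfl
  | m + 1, ω => by
    simp [PersonalizedLearner.transcript, L.length_transcript m]

/-- If no slot of distribution `i` is retired, they all lie in the half that is kept. -/
theorem card_slots_eq_of_not_retired {k : ℕ} (e : Equiv.Perm (Bool × Fin k))
    (a : Bool × Fin k → Fin k)
    {i : Fin k} (h : ∀ j, a (e (true, j)) ≠ i) :
    (Finset.univ.filter fun u => a u = i).card =
      (Finset.univ.filter fun j => a (e (false, j)) = i).card := by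
  symm
  refine Finset.card_bij (fun j _ => e (false, j)) (fun j hj => ?_) (fun j _ j' _ hjj => ?_)
    fun u hu => ?_
  · simpa using hj
  · simpa using hjj
  · obtain ⟨⟨b, j⟩, rfl⟩ := e.surjective u
    have hu' : a (e (b, j)) = i := by simpa using hu
    cases b
    · exact ⟨j, by simpa using hu', rfl⟩
    · exact absurd hu' (h j)

namespace RoundRule

variable {X : Type*} [MeasurableSpace X] {k : ℕ} (A : RoundRule X k) (R : ℕ)

/-- The sequence of the examples in a transcript, continued arbitrarily. -/
noncomputable def examples [Nonempty X] (L : List (X × Bool × Fin k)) : ℕ → X × Bool :=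
  fun t => (L[t]?).elim (Classical.arbitrary _) fun e => (e.1, e.2.1)

/-- At the end of an epoch, `g` is a round of this epoch in which distribution `i` lost a slot. -/
def RetiredAt [Nonempty X] (L : List (X × Bool × Fin k)) (i : Fin k) (g : ℕ) : Prop :=
  (∃ j, L.length = roundStart k R ((j + 1) * R) ∧ j * R ≤ g ∧ g < (j + 1) * R) ∧
    A.Retires R g (examples L) i

/-- The learner that runs the rounds one after the other. It returns for each distribution the
hypothesis of a round of the last epoch in which the distribution lost a slot. The default is a fair
coin. -/
noncomputable def learner [Nonempty X] [NeZero k] : PersonalizedLearner X k where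
  query L := A.nextQuery R L.length (examples L)
  output L i x :=
    open Classical in
    if h : ∃ g, A.RetiredAt R L i g then
      PMF.pure (A.hyp _ (data k R h.choose (examples L)) x)
    else PMF.uniformOfFintype Bool
  measurable_output L i y := by
    by_cases h : ∃ g, A.RetiredAt R L i g
    · simp only [dif_pos h]
      exact (measurable_of_countable fun b : Bool => PMF.pure b y).comp (A.measurable_hyp _ _)
    · simp only [dif_neg h]
      exact measurable_const

/-- The number of slots of a distribution that is not retired doubles in each round, so within an
epoch every distribution is retired. -/
theorem exists_retires [NeZero k] (hR : 0 < R) (hkR : k < 2 ^ R) (j : ℕ) (z : ℕ → X × Bool)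
    (i : Fin k) : ∃ g, j * R ≤ g ∧ g < (j + 1) * R ∧ A.Retires R g z i := by
  by_contra hcon
  have hnot : ∀ ρ < R, ∀ b, A.state R (j * R + ρ) z
      (A.sel _ (data k R (j * R + ρ) z) (true, b)) ≠ i := by
    intro ρ hρ b hb
    refine hcon ⟨j * R + ρ, Nat.le_add_right _ _, ?_, b, hb⟩
    rw [Nat.add_mul, one_mul]
    omega
  have hdouble : ∀ β : Fin k → Fin k, (Finset.univ.filter fun u : Bool × Fin k => β u.2 = i).card =
      2 * (Finset.univ.filter fun b => β b = i).card := by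
    intro β
    have : (Finset.univ.filter fun u : Bool × Fin k => β u.2 = i) =
        Finset.univ ×ˢ (Finset.univ.filter fun b => β b = i) := by ext u; simp
    rw [this, Finset.card_product, Finset.card_univ, Fintype.card_bool]
  have hgrow : ∀ ρ < R, 2 ^ (ρ + 1) ≤
      (Finset.univ.filter fun u => A.state R (j * R + ρ) z u = i).card := by
    intro ρ
    induction ρ with
    | zero =>
      intro _
      have h0 : A.state R (j * R + 0) z = Prod.snd := by
        rw [add_zero]
        rcases h : j * R with _ | g
        · rfl
        · simp only [state]
          rw [if_pos (by rw [← h]; exact Nat.mul_mod_left _ _)]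
      rw [h0, hdouble fun b => b, Finset.filter_eq' Finset.univ i]
      simp
    | succ ρ ih =>
      intro hρ
      have h1 := ih (by omega)
      rw [card_slots_eq_of_not_retired _ _ (hnot ρ (by omega))] at h1
      have h2 : A.state R (j * R + (ρ + 1)) z = fun u => A.state R (j * R + ρ) z
          (A.sel _ (data k R (j * R + ρ) z) (false, u.2)) := by
        rw [← add_assoc]
        simp only [state]
        rw [if_neg]
        rw [add_assoc, Nat.mul_add_mod_self_right, Nat.mod_eq_of_lt hρ]
        omega
      rw [h2, hdouble fun b => A.state R (j * R + ρ) z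
          (A.sel _ (data k R (j * R + ρ) z) (false, b)), pow_succ, mul_comm]
      gcongr
  have h1 := hgrow (R - 1) (by omega)
  rw [card_slots_eq_of_not_retired _ _ (hnot (R - 1) (by omega)), Nat.sub_add_cancel hR] at h1
  have h2 := Finset.card_le_univ (Finset.univ.filter fun b => A.state R (j * R + (R - 1)) z
    (A.sel _ (data k R (j * R + (R - 1)) z) (false, b)) = i)
  rw [Fintype.card_fin] at h2
  omega

variable [Nonempty X] [NeZero k]

/-- The examples that the learner sees. -/
noncomputable def observed (m : ℕ) (ω : Fin m → Fin k → X × Bool) : ℕ → X × Bool :=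
  examples ((A.learner R).transcript m ω)

theorem observed_apply : ∀ (m : ℕ) (ω : Fin m → Fin k → X × Bool) (t : ℕ) (ht : t < m),
    A.observed R m ω t = ω ⟨t, ht⟩ (A.nextQuery R t (A.observed R m ω))
  | m + 1, ω, t, ht => by
    set L := (A.learner R).transcript m (Fin.init ω) with hL
    have hlen : L.length = m := PersonalizedLearner.length_transcript _ _ _
    have htr : (A.learner R).transcript (m + 1) ω =
      L ++ [((ω (Fin.last m) ((A.learner R).query L)).1,
        (ω (Fin.last m) ((A.learner R).query L)).2, (A.learner R).query L)] := rfl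
    have hagree : ∀ t' < m, A.observed R (m + 1) ω t' = A.observed R m (Fin.init ω) t' := by
      intro t' ht'
      simp only [observed, examples, htr, ← hL]
      rw [List.getElem?_append_left (by omega)]
    have hq : ∀ t' ≤ m, A.nextQuery R t' (A.observed R (m + 1) ω) =
        A.nextQuery R t' (A.observed R m (Fin.init ω)) := fun t' ht' =>
      A.nextQuery_congr R fun s hs => hagree s (by omega)
    rcases Nat.lt_succ_iff_lt_or_eq.1 ht with h | rfl
    · rw [hagree t h, hq t h.le, observed_apply m (Fin.init ω) t h]
      rfl
    · rw [hq t le_rfl]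
      have : (A.learner R).query L = A.nextQuery R t (A.observed R t (Fin.init ω)) := by
        change A.nextQuery R L.length _ = _
        rw [hlen]
        rfl
      simp only [← this]
      simp only [observed, examples, htr]
      rw [List.getElem?_append_right (by omega)]
      simp [hlen]
      rfl

/-- The examples seen before time `T` depend only on the oracle answers before time `T`. -/
theorem observed_congr {m : ℕ} {ω ω' : Fin m → Fin k → X × Bool} {T : ℕ} (hT : T ≤ m)
    (h : ∀ i : Fin m, i.1 < T → ω i = ω' i) (t : ℕ) (ht : t < T) :
    A.observed R m ω t = A.observed R m ω' t := by
  induction t using Nat.strong_induction_on with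
  | _ t ih =>
    rw [observed_apply A R m ω t (by omega), observed_apply A R m ω' t (by omega), h _ ht,
      A.nextQuery_congr R fun t' ht' => ih t' ht' (by omega)]

theorem measurable_observed (m t : ℕ) (ht : t < m) :
    Measurable fun ω => A.observed R m ω t := by
  induction t using Nat.strong_induction_on with
  | _ t ih =>
    let trunc : (ℕ → X × Bool) → ℕ → X × Bool :=
      fun z t' => if t' < t then z t' else Classical.arbitrary _
    have htr : Measurable fun ω => trunc (A.observed R m ω) := by
      refine measurable_pi_lambda _ fun t' => ?_
      by_cases h : t' < t
      · simpa only [trunc, if_pos h] using ih t' h (by omega)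
      · simp only [trunc, if_neg h]; exact measurable_const
    have hq : Measurable fun ω => A.nextQuery R t (A.observed R m ω) := by
      have : (fun ω => A.nextQuery R t (A.observed R m ω)) =
          fun ω => A.nextQuery R t (trunc (A.observed R m ω)) := by
        funext ω
        exact A.nextQuery_congr R fun t' ht' => by simp only [trunc, if_pos ht']
      rw [this]
      exact (A.measurable_nextQuery R t).comp htr
    have hev : Measurable fun p : (Fin m → Fin k → X × Bool) × Fin k => p.1 ⟨t, ht⟩ p.2 :=
      measurable_from_prod_countable_left fun i =>
        (measurable_pi_apply i).comp (measurable_pi_apply (⟨t, ht⟩ : Fin m))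
    have : (fun ω => A.observed R m ω t) =
        fun ω => ω ⟨t, ht⟩ (A.nextQuery R t (A.observed R m ω)) :=
      funext fun ω => observed_apply A R m ω t ht
    rw [this]
    exact hev.comp (measurable_id.prodMk hq)

theorem measurableSet_state_observed {m g : ℕ} (hg : roundStart k R g ≤ m)
    (a : Bool × Fin k → Fin k) : MeasurableSet {ω | A.state R g (A.observed R m ω) = a} := by
  let trunc : (ℕ → X × Bool) → ℕ → X × Bool :=
    fun z t => if t < roundStart k R g then z t else Classical.arbitrary _
  have htr : Measurable fun ω => trunc (A.observed R m ω) := by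
    refine measurable_pi_lambda _ fun t => ?_
    by_cases h : t < roundStart k R g
    · simpa only [trunc, if_pos h] using A.measurable_observed R m t (by omega)
    · simp only [trunc, if_neg h]; exact measurable_const
  have : (fun ω => A.state R g (A.observed R m ω)) =
      fun ω => A.state R g (trunc (A.observed R m ω)) := by
    funext ω
    exact A.state_congr R fun t' ht' => by simp only [trunc, if_pos ht']
  have hm : Measurable fun ω => A.state R g (A.observed R m ω) := by
    rw [this]
    exact (A.measurable_state R g).comp htr
  exact measurableSet_eq_fun hm measurable_const

/-- The sample of a round has the law that belongs to the state of the algorithm, so an event that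
is unlikely under each of these laws is unlikely. -/
theorem measure_round_le (D : Fin k → Measure (X × Bool)) [∀ i, IsProbabilityMeasure (D i)]
    {m g : ℕ} (hg : roundStart k R (g + 1) ≤ m)
    (B : (Bool × Fin k → Fin k) → Set (RoundIndex k (roundSize R g) → X × Bool)) {c : ENNReal}
    (hB : ∀ a, (Measure.pi fun s : RoundIndex k (roundSize R g) => D (a s.slot)) (B a) ≤ c) :
    (Measure.pi fun _ : Fin m => Measure.pi D)
      {ω | data k R g (A.observed R m ω) ∈ B (A.state R g (A.observed R m ω))} ≤ c := by
  have hlt : ∀ s : RoundIndex k (roundSize R g), roundTime k R g s < m := fun s =>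
    (roundTime_lt k R g s).trans_le hg
  have hgm : roundStart k R g ≤ m :=
    ((roundStart_strictMono k R) (Nat.lt_succ_self g)).le.trans hg
  let τ : RoundIndex k (roundSize R g) → Fin m := fun s => ⟨roundTime k R g s, hlt s⟩
  have hτ : Function.Injective τ := by
    intro s s' h
    have h2 : (⟨g, s⟩ : Σ g, RoundIndex k (roundSize R g)) = ⟨g, s'⟩ :=
      roundTime_injective k R (congrArg Fin.val h)
    simpa using h2
  have hdata : ∀ ω, data k R g (A.observed R m ω) =
      fun s => ω (τ s) (A.state R g (A.observed R m ω) s.slot) := by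
    intro ω
    funext s
    rw [data, observed_apply A R m ω _ (hlt s), nextQuery_roundTime]
  have hmain := measure_mem_of_depends_le (fun _ : Fin m => Measure.pi D)
    (fun i => i.1 < roundStart k R g) (fun ω => A.state R g (A.observed R m ω))
    (fun ω ω' h => A.state_congr R fun t ht => A.observed_congr R hgm h t ht)
    (A.measurableSet_state_observed R hgm)
    (fun a => {ω | (fun s => ω (τ s) (a s.slot)) ∈ B a})
    (fun a ω ω' h hω => by
      have : (fun s => ω (τ s) (a (RoundIndex.slot s))) = fun s => ω' (τ s) (a s.slot) := by
        funext s
        rw [h (τ s) (not_lt.2 (roundStart_le_roundTime k R g s))]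
      change _ ∈ B a
      rw [← this]
      exact hω)
    (fun a => (measure_pi_select_le D hτ (fun s => a s.slot) (B a)).trans (hB a))
  refine (measure_mono fun ω hω => ?_).trans hmain
  rw [Set.mem_ofPred_eq, hdata ω] at hω
  exact hω

/-- If the rule of a round fails with probability at most `c` under every assignment of the
distributions to the slots, then the learner fails with probability at most `R * c`. -/
theorem measure_learner_fails_le (hR : 0 < R) (hkR : k < 2 ^ R) (ℓ : Bool → X × Bool → ℝ)
    (D : Fin k → Measure (X × Bool)) [∀ i, IsProbabilityMeasure (D i)] (j : ℕ) (T : ℝ)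
    {c : ENNReal}
    (hc : ∀ a : Bool × Fin k → Fin k,
      (Measure.pi fun s : RoundIndex k (2 ^ j) => D (a s.slot))
        {y | ∃ b, T < detRisk ℓ (D (a (A.sel _ y (true, b)))) (A.hyp _ y)} ≤ c) :
    (Measure.pi fun _ : Fin (roundStart k R ((j + 1) * R)) => Measure.pi D)
      {ω | ¬ ∀ i, risk ℓ (D i) ((A.learner R).output
        ((A.learner R).transcript (roundStart k R ((j + 1) * R)) ω) i) ≤ T} ≤ R * c := by
  set m := roundStart k R ((j + 1) * R) with hm
  let B (g : ℕ) (a : Bool × Fin k → Fin k) : Set (RoundIndex k (roundSize R g) → X × Bool) :=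
    {y | ∃ b, T < detRisk ℓ (D (a (A.sel _ y (true, b)))) (A.hyp _ y)}
  have hdiv : ∀ ρ < R, (j * R + ρ) / R = j := by
    intro ρ hρ
    rw [Nat.add_comm, Nat.add_mul_div_right _ _ hR, Nat.div_eq_of_lt hρ, zero_add]
  have hround : ∀ ρ ∈ Finset.range R, (Measure.pi fun _ : Fin m => Measure.pi D)
      {ω | data k R (j * R + ρ) (A.observed R m ω) ∈
        B (j * R + ρ) (A.state R (j * R + ρ) (A.observed R m ω))} ≤ c := by
    intro ρ hρ
    rw [Finset.mem_range] at hρ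
    refine A.measure_round_le R D ?_ _ fun a => ?_
    · refine (roundStart_strictMono k R).monotone ?_
      rw [Nat.add_mul, one_mul]
      omega
    · have h := hc a
      rw [← hdiv ρ hρ] at h
      exact h
  have hsub : {ω | ¬ ∀ i, risk ℓ (D i) ((A.learner R).output
        ((A.learner R).transcript m ω) i) ≤ T} ⊆ ⋃ ρ ∈ Finset.range R,
      {ω | data k R (j * R + ρ) (A.observed R m ω) ∈
        B (j * R + ρ) (A.state R (j * R + ρ) (A.observed R m ω))} := by
    intro ω hω
    by_contra hgood
    simp only [Set.mem_iUnion, not_exists, Finset.mem_range] at hgood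
    refine hω fun i => ?_
    have hlen : ((A.learner R).transcript m ω).length = m :=
      PersonalizedLearner.length_transcript _ _ _
    obtain ⟨g, hg1, hg2, hg3⟩ := A.exists_retires R hR hkR j (A.observed R m ω) i
    have hex : ∃ g, A.RetiredAt R ((A.learner R).transcript m ω) i g :=
      ⟨g, ⟨j, hlen, hg1, hg2⟩, hg3⟩
    have hout : (A.learner R).output ((A.learner R).transcript m ω) i = fun x => PMF.pure
        (A.hyp _ (data k R hex.choose (A.observed R m ω)) x) := by
      funext x
      exact dif_pos hex
    rw [hout, risk_pure]
    obtain ⟨⟨j', hj', h1, h2⟩, b, hb⟩ := hex.choose_spec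
    rw [hlen, hm] at hj'
    have hjj : j = j' := by
      have := (roundStart_strictMono k R).injective hj'
      have := Nat.eq_of_mul_eq_mul_right hR this
      omega
    subst hjj
    have h3 := hgood (hex.choose - j * R) (by rw [Nat.add_mul, one_mul] at h2; omega)
    rw [Nat.add_sub_cancel' h1] at h3
    by_contra hlt
    refine h3 ⟨b, ?_⟩
    rw [not_le] at hlt
    change A.state R hex.choose (A.observed R m ω)
      (A.sel _ (data k R hex.choose (A.observed R m ω)) (true, b)) = i at hb
    rw [hb]
    exact hlt
  calc _ ≤ _ := measure_mono hsub
    _ ≤ _ := measure_biUnion_finset_le _ _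
    _ ≤ ∑ _ρ ∈ Finset.range R, c := Finset.sum_le_sum hround
    _ = R * c := by simp

end RoundRule

/-! ### The rule of a round -/

/-- Split the sample of a round into its cover, training and test parts. -/
def splitSample {Z : Type*} {k N : ℕ} (y : RoundIndex k N → Z) :
    (((Bool × Fin k) × Fin N → Z) × ((Bool × Fin k) × Fin N → Z)) × ((Bool × Fin k) × Fin N → Z) :=
  ((fun i => y (.inl (.inl i)), fun i => y (.inl (.inr i))), fun i => y (.inr i))

theorem measurePreserving_splitSample {X : Type*} [MeasurableSpace X] {k : ℕ} (N : ℕ)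
    (D : Bool × Fin k → Measure (X × Bool)) [∀ u, IsProbabilityMeasure (D u)] :
    MeasurePreserving splitSample (Measure.pi fun s : RoundIndex k N => D s.slot)
      (((sampleLaw D N).prod (sampleLaw D N)).prod (sampleLaw D N)) := by
  have h1 := measurePreserving_sumPiEquivProdPi
    (X := fun _ : RoundIndex k N => X × Bool) fun s => D (RoundIndex.slot s)
  have h2 := measurePreserving_sumPiEquivProdPi
    (X := fun _ : ((Bool × Fin k) × Fin N) ⊕ ((Bool × Fin k) × Fin N) => X × Bool)
    fun s => D (RoundIndex.slot (.inl s))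
  exact (h2.prod (MeasurePreserving.id (sampleLaw D N))).comp h1

/-- `exists_round`, with the three samples of a round indexed by a single type. -/
theorem exists_roundRule {X : Type*} [MeasurableSpace X] {H : Set (X → Bool)} {d : ℕ}
    {ℓ : Bool → X × Bool → ℝ} (hne : H.Nonempty) (hH : MeasurableClass H)
    (hd : classVCDim H ≤ d) (hℓ : ∀ y, Measurable (ℓ y))
    (h01 : ∀ y z, ℓ y z ∈ Set.Icc (0 : ℝ) 1) {k : ℕ} (hk : 1 ≤ k) :
    ∃ A : RoundRule X k, ∀ N, 1 ≤ N →
      ∀ (D : Fin k → Measure (X × Bool)) [∀ i, IsProbabilityMeasure (D i)],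
        ∀ f ∈ H, ∀ M, (∀ i, detRisk ℓ (D i) f ≤ M) → ∀ ε, 0 < ε → ε ≤ 1 / 3 →
          ∀ a : Bool × Fin k → Fin k, (Measure.pi fun s : RoundIndex k N => D (a s.slot))
            {y | ∃ b, M + 5 * ε < detRisk ℓ (D (a (A.sel _ y (true, b)))) (A.hyp _ y)} ≤
            ENNReal.ofReal (3 * ((4 * k * N + 1) ^ d * (2 * k).factorial *
              Real.exp (-2 * ε ^ 2 * (k * N))) + 4 * k * Real.exp (-2 * ε ^ 2 * N)) := by
  choose hyp sel hypH hsel hmain using fun N => exists_round hne hH hd hℓ h01 hk N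
  have hsplit : ∀ N, Measurable (splitSample (Z := X × Bool) (k := k) (N := N)) := fun N => by
    unfold splitSample
    fun_prop
  refine ⟨⟨fun N y => hyp N (splitSample y), fun N y => sel N (splitSample y),
    fun N c => hH.measurable_mem _ (hypH _ _), fun N e => hsplit N (hsel N e)⟩, ?_⟩
  intro N hN D _ f hf M hM ε hε hε3 a
  have h := hmain N hN (fun u => D (a u)) f hf M (fun u => hM _) ε hε hε3
  have hmp := measurePreserving_splitSample N fun u => D (a u)
  rw [← hmp.map_eq] at h
  exact (Measure.le_map_apply hmp.measurable.aemeasurable _).trans h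

/-! ### The optimal risk -/

section Opt

variable {X : Type*} [MeasurableSpace X] {H : Set (X → Bool)} {ℓ : Bool → X × Bool → ℝ} {k : ℕ}
  (D : Fin k → Measure (X × Bool))

theorem exists_detRisk_le_opt_add (hne : H.Nonempty) {ε : ℝ} (hε : 0 < ε) :
    ∃ f ∈ H, ∀ i, detRisk ℓ (D i) f ≤ opt ℓ H D + ε := by
  have : Nonempty H := hne.to_subtype
  obtain ⟨f, hf⟩ := exists_lt_of_ciInf_lt (show opt ℓ H D < opt ℓ H D + ε by linarith)
  refine ⟨f, f.2, fun i => le_trans ?_ hf.le⟩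
  rw [← risk_pure]
  exact le_ciSup (f := fun i => risk ℓ (D i) fun x => PMF.pure (f.1 x))
    (Set.finite_range _).bddAbove i

/-- A lower bound for the risk of every hypothesis on a single distribution is one for `opt`. -/
theorem le_opt_add (hne : H.Nonempty) {r c : ℝ} (i : Fin k)
    (h : ∀ f ∈ H, r ≤ detRisk ℓ (D i) f + c) : r ≤ opt ℓ H D + c := by
  have : Nonempty H := hne.to_subtype
  rw [← sub_le_iff_le_add]
  refine le_ciInf fun f => ?_
  rw [sub_le_iff_le_add]
  refine (h f f.2).trans ?_
  rw [← risk_pure]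
  gcongr
  exact le_ciSup (f := fun i => risk ℓ (D i) fun x => PMF.pure (f.1 x))
    (Set.finite_range _).bddAbove i

/-- A fair coin exceeds the risk of any hypothesis by at most one half. -/
theorem risk_uniform_le (hℓ : ∀ y, Measurable (ℓ y)) (h01 : ∀ y z, ℓ y z ∈ Set.Icc (0 : ℝ) 1)
    (P : Measure (X × Bool)) [IsProbabilityMeasure P] {f : X → Bool} (hf : Measurable f) :
    risk ℓ P (fun _ => PMF.uniformOfFintype Bool) ≤ detRisk ℓ P f + 1 / 2 := by
  have hint : ∀ g : X × Bool → ℝ, Measurable g → (∀ z, g z ∈ Set.Icc (0 : ℝ) 1) →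
      Integrable g P := fun g hg h =>
    Integrable.of_mem_Icc 0 1 hg.aemeasurable (ae_of_all _ h)
  have hfi := hint (fun z => ℓ (f z.1) z)
    (measurable_loss_comp hℓ (hf.comp measurable_fst) measurable_id) fun z => h01 _ z
  have h1 : ∫ z, (ℓ (f z.1) z + 1 / 2) ∂P = detRisk ℓ P f + 1 / 2 := by
    rw [integral_add hfi (integrable_const _)]
    simp [detRisk]
  have h2 : ∀ z, ∑ y : Bool, ((PMF.uniformOfFintype Bool) y).toReal * ℓ y z =
      (ℓ true z + ℓ false z) / 2 := by
    intro z
    simp only [PMF.uniformOfFintype_apply, Fintype.card_bool, Fintype.sum_bool]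
    norm_num
    ring
  rw [← h1]
  unfold risk
  simp only [h2]
  refine integral_mono ?_ (hfi.add (integrable_const _)) fun z => ?_
  · exact ((hint _ (hℓ true) (h01 true)).add (hint _ (hℓ false) (h01 false))).div_const 2
  · have ht := h01 true z
    have hfz := h01 false z
    rw [Set.mem_Icc] at ht hfz
    simp only
    cases f z.1 <;> linarith [ht.1, ht.2, hfz.1, hfz.2]

end Opt

theorem eq_of_mem_of_classVCDim_eq_zero {X : Type*} {H : Set (X → Bool)} (hd : classVCDim H = 0)
    {f g : X → Bool} (hf : f ∈ H) (hg : g ∈ H) : f = g := by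
  by_contra hne
  obtain ⟨x, hx⟩ := Function.ne_iff.1 hne
  have hsh : ShattersFinset H {x} := by
    intro b
    by_cases h : f x = b x
    · exact ⟨f, hf, fun y hy => by rw [Finset.mem_singleton.1 hy, h]⟩
    · refine ⟨g, hg, fun y hy => ?_⟩
      rw [Finset.mem_singleton.1 hy]
      revert h hx
      cases f x <;> cases g x <;> cases b x <;> simp
  have h1 : ((({x} : Finset X).card : ℕ) : ℕ∞) ≤ classVCDim H :=
    le_iSup₂ (f := fun (S : Finset X) (_ : ShattersFinset H S) => (S.card : ℕ∞)) _ hsh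
  rw [hd] at h1
  simp at h1

/-! ### The sample complexity -/

/-- The epochs up to the `j`-th last at most twice as long as the `j`-th epoch. -/
theorem roundStart_le {k R j : ℕ} : roundStart k R ((j + 1) * R) ≤ 12 * k * R * 2 ^ j := by
  have h : roundStart k R ((j + 1) * R) + 6 * k * R = 12 * k * R * 2 ^ j := by
    induction j with
    | zero =>
      have : ∀ i ∈ Finset.range R, 6 * k * roundSize R i = 6 * k := by
        intro i hi
        rw [roundSize, Nat.div_eq_of_lt (Finset.mem_range.1 hi)]
        simp
      rw [roundStart, zero_add, one_mul, Finset.sum_congr rfl this]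
      simp
      ring
    | succ j ih =>
      have : ∀ i ∈ Finset.range R, 6 * k * roundSize R ((j + 1) * R + i) = 6 * k * 2 ^ (j + 1) := by
        intro i hi
        rw [Finset.mem_range] at hi
        rw [roundSize, Nat.add_comm, Nat.add_mul_div_right _ _ (by omega), Nat.div_eq_of_lt hi,
          zero_add]
      unfold roundStart at ih ⊢
      rw [show (j + 1 + 1) * R = (j + 1) * R + R by ring, Finset.sum_range_add,
        Finset.sum_congr rfl this, Finset.sum_const, Finset.card_range, smul_eq_mul]
      rw [pow_succ]
      nlinarith
  omega

/-- The number of rounds in an epoch. -/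
def epochLength (k : ℕ) : ℕ := Nat.log 2 k + 1

theorem epochLength_le_self {k : ℕ} (hk : 1 ≤ k) : epochLength k ≤ k :=
  Nat.log_lt_self 2 (by omega)

theorem epochLength_le_log {k : ℕ} (hk : 1 ≤ k) :
    (epochLength k : ℝ) ≤ 3 * max 1 (Real.log k) := by
  have h1 : (2 : ℝ) ^ Nat.log 2 k ≤ k := by exact_mod_cast Nat.pow_log_le_self 2 (by omega)
  have h2 := Real.log_le_log (by positivity) h1
  rw [Real.log_pow] at h2
  have h3 := Real.log_two_gt_d9
  have h4 : (Nat.log 2 k : ℝ) * 0.5 ≤ Nat.log 2 k * Real.log 2 := by gcongr; linarith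
  have h5 := le_max_left 1 (Real.log k)
  have h6 := le_max_right 1 (Real.log k)
  rw [epochLength]
  push_cast
  linarith

/-- Conditions on the sample size `N` per slot and round under which an epoch succeeds. -/
theorem epoch_failure_le {k d : ℕ} (hk : 1 ≤ k) {N ε δ : ℝ} (hN : 0 ≤ N)
    (hδ : δ ∈ Set.Ioo (0 : ℝ) 1)
    (h1 : 3 + 2 * Real.log (k / δ) ≤ 2 * ε ^ 2 * N)
    (h2 : d * Real.log (4 * k * N + 1) + 4 * k * (Real.log (k / δ) + 1) ≤ 2 * ε ^ 2 * (k * N)) :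
    (epochLength k : ℝ) * (3 * ((4 * k * N + 1) ^ d * (2 * k).factorial *
      Real.exp (-2 * ε ^ 2 * (k * N))) + 4 * k * Real.exp (-2 * ε ^ 2 * N)) ≤ δ := by
  obtain ⟨hδ0, hδ1⟩ := hδ
  have hk1 : (1 : ℝ) ≤ k := by exact_mod_cast hk
  have hk0 : (0 : ℝ) < k := by linarith
  have hR : (epochLength k : ℝ) ≤ k := by exact_mod_cast epochLength_le_self hk
  have hb : Real.log (k / δ) = Real.log k - Real.log δ := Real.log_div hk0.ne' hδ0.ne'
  have hlk : 0 ≤ Real.log k := Real.log_nonneg hk1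
  have hlδ : Real.log δ ≤ 0 := Real.log_nonpos hδ0.le hδ1.le
  have hl2 := Real.log_two_lt_d9
  have hl2' := Real.log_two_gt_d9
  have hA : (k : ℝ) * (4 * k * Real.exp (-2 * ε ^ 2 * N)) ≤ δ / 2 := by
    have e1 : (8 : ℝ) * k ^ 2 / δ = Real.exp (3 * Real.log 2 + 2 * Real.log k - Real.log δ) := by
      rw [Real.exp_sub, Real.exp_add, Real.exp_log hδ0,
        show (3 : ℝ) * Real.log 2 = Real.log (2 ^ 3) by rw [Real.log_pow]; norm_num,
        show (2 : ℝ) * Real.log k = Real.log (k ^ 2) by rw [Real.log_pow]; norm_num,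
        Real.exp_log (by positivity), Real.exp_log (by positivity)]
      norm_num
    have e2 : (8 : ℝ) * k ^ 2 / δ * Real.exp (-2 * ε ^ 2 * N) ≤ 1 := by
      rw [e1, ← Real.exp_add]
      refine Real.exp_le_one_iff.2 ?_
      rw [hb] at h1
      nlinarith
    have e3 : (k : ℝ) * (4 * k * Real.exp (-2 * ε ^ 2 * N)) =
        δ / 2 * (8 * k ^ 2 / δ * Real.exp (-2 * ε ^ 2 * N)) := by
      field_simp; ring
    rw [e3]
    exact mul_le_of_le_one_right (by positivity) e2
  have hfac : ((2 * k).factorial : ℝ) ≤ Real.exp (2 * k * (Real.log 2 + Real.log k)) := by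
    have f1 : ((2 * k).factorial : ℝ) ≤ (2 * k : ℝ) ^ (2 * k) := by
      exact_mod_cast Nat.factorial_le_pow (2 * k)
    refine f1.trans (le_of_eq ?_)
    rw [← Real.log_mul (by norm_num) hk0.ne', mul_comm (2 * (k : ℝ)) (Real.log _), Real.exp_mul,
      Real.exp_log (by positivity)]
    exact_mod_cast (Real.rpow_natCast (2 * (k : ℝ)) (2 * k)).symm
  have hpow : (4 * k * N + 1) ^ d = Real.exp (d * Real.log (4 * k * N + 1)) := by
    rw [Real.exp_nat_mul, Real.exp_log (by positivity)]
  have hB : (k : ℝ) * (3 * ((4 * k * N + 1) ^ d * (2 * k).factorial *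
      Real.exp (-2 * ε ^ 2 * (k * N)))) ≤ δ / 2 := by
    have e1 : (6 : ℝ) * k / δ ≤ Real.exp (2 + Real.log k - Real.log δ) := by
      rw [Real.exp_sub, Real.exp_add, Real.exp_log hδ0, Real.exp_log hk0]
      have : (6 : ℝ) ≤ Real.exp 2 := by
        have := Real.exp_one_gt_d9
        rw [show (2 : ℝ) = 1 + 1 by norm_num, Real.exp_add]
        nlinarith
      gcongr
    have e2 : (6 : ℝ) * k / δ * ((4 * k * N + 1) ^ d * (2 * k).factorial *
        Real.exp (-2 * ε ^ 2 * (k * N))) ≤ 1 := by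
      rw [hpow]
      calc _ ≤ Real.exp (2 + Real.log k - Real.log δ) *
            (Real.exp (d * Real.log (4 * k * N + 1)) *
            Real.exp (2 * k * (Real.log 2 + Real.log k)) * Real.exp (-2 * ε ^ 2 * (k * N))) := by
            gcongr
        _ ≤ 1 := by
          rw [← Real.exp_add, ← Real.exp_add, ← Real.exp_add]
          refine Real.exp_le_one_iff.2 ?_
          rw [hb] at h2
          have e3 : (k : ℝ) * Real.log 2 ≤ k * 0.7 := by gcongr; linarith
          have e4 : Real.log k ≤ k * Real.log k := le_mul_of_one_le_left hlk hk1
          have e5 : -Real.log δ ≤ k * -Real.log δ := le_mul_of_one_le_left (by linarith) hk1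
          nlinarith
    have e3 : (k : ℝ) * (3 * ((4 * k * N + 1) ^ d * (2 * k).factorial *
        Real.exp (-2 * ε ^ 2 * (k * N)))) = δ / 2 * (6 * k / δ * ((4 * k * N + 1) ^ d *
        (2 * k).factorial * Real.exp (-2 * ε ^ 2 * (k * N)))) := by
      field_simp; ring
    rw [e3]
    exact mul_le_of_le_one_right (by positivity) e2
  calc _ ≤ (k : ℝ) * (3 * ((4 * k * N + 1) ^ d * (2 * k).factorial *
      Real.exp (-2 * ε ^ 2 * (k * N))) + 4 * k * Real.exp (-2 * ε ^ 2 * N)) := by gcongr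
    _ ≤ δ := by rw [mul_add]; linarith

/-- Solves the implicit condition on the sample size, which occurs in the logarithm on one side. -/
theorem log_le_of_le_polynomial {x Q L : ℝ} (hQ : 2 ≤ Q) (hL : 0 ≤ L) (hx0 : 0 < x)
    (hx : x ≤ 22000 * (Q ^ 4 * (1 + L))) :
    Real.log x ≤ 50 * (Real.log Q * (1 + Real.log (1 + L))) := by
  have hl2 := Real.log_two_gt_d9
  have hQ0 : 0 < Q := by linarith
  have ha : Real.log 2 ≤ Real.log Q := Real.log_le_log (by norm_num) hQ
  have hW : 0 ≤ Real.log (1 + L) := Real.log_nonneg (by linarith)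
  have h4 : (22000 : ℝ) ≤ Real.exp 10 := by
    have := Real.exp_one_gt_d9
    have h5 : Real.exp 10 = Real.exp 1 ^ 10 := by rw [← Real.exp_nat_mul]; norm_num
    rw [h5]
    calc (22000 : ℝ) ≤ 2.718 ^ 10 := by norm_num
      _ ≤ _ := by gcongr; linarith
  have h5 : Real.log x ≤ 10 + 4 * Real.log Q + Real.log (1 + L) := by
    calc Real.log x ≤ Real.log (Real.exp 10 * (Q ^ 4 * (1 + L))) := by
          refine Real.log_le_log hx0 (hx.trans ?_)
          gcongr
      _ = _ := by
          rw [Real.log_mul (by positivity) (by positivity),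
            Real.log_mul (by positivity) (by positivity), Real.log_exp, Real.log_pow]
          push_cast
          ring
  have h6 : 0.69 * (1 + Real.log (1 + L)) ≤ Real.log Q * (1 + Real.log (1 + L)) := by
    gcongr; linarith
  have h7 : Real.log Q ≤ Real.log Q * (1 + Real.log (1 + L)) :=
    le_mul_of_one_le_right (by linarith) (by linarith)
  linarith

/-- A sample size that suffices for the accuracy `ε / 6` and the resulting number of queries. -/
theorem exists_epoch {k d : ℕ} (hk : 1 ≤ k) (hd : 1 ≤ d) {ε δ : ℝ}
    (hε : ε ∈ Set.Ioo (0 : ℝ) (1 / 2)) (hδ : δ ∈ Set.Ioo (0 : ℝ) 1) :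
    ∃ j : ℕ, (epochLength k : ℝ) * (3 * ((4 * k * (2 ^ j : ℕ) + 1) ^ d * (2 * k).factorial *
        Real.exp (-2 * (ε / 6) ^ 2 * (k * (2 ^ j : ℕ)))) +
        4 * k * Real.exp (-2 * (ε / 6) ^ 2 * (2 ^ j : ℕ))) ≤ δ ∧
      (12 * k * epochLength k * 2 ^ j : ℝ) ≤
        200000 * ((1 / ε ^ 2) * max 1 (Real.log k) *
          (d * Real.log (d * k / ε) + k * Real.log (k / δ))) *
          (1 + Real.log (1 + Real.log ((d + 1) * k / (ε * δ)))) := by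
  obtain ⟨hε0, hε1⟩ := hε
  obtain ⟨hδ0, hδ1⟩ := hδ
  have hk1 : (1 : ℝ) ≤ k := by exact_mod_cast hk
  have hk0 : (0 : ℝ) < k := by linarith
  have hd1 : (1 : ℝ) ≤ d := by exact_mod_cast hd
  have hl2 := Real.log_two_gt_d9
  set Q : ℝ := d * k / ε with hQ
  set a := Real.log Q with ha
  set b := Real.log (k / δ) with hb
  set L := Real.log ((d + 1) * k / (ε * δ)) with hL
  set Λ := 1 + Real.log (1 + L) with hΛ
  have hdk : (1 : ℝ) ≤ d * k := one_le_mul_of_one_le_of_one_le hd1 hk1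
  have hQ2 : 2 ≤ Q := by rw [hQ, le_div_iff₀ hε0]; linarith
  have ha1 : Real.log 2 ≤ a := Real.log_le_log (by norm_num) hQ2
  have ha0 : 0 ≤ a := by linarith
  have ha2 : a ≤ Q := by linarith [Real.log_le_sub_one_of_pos (show 0 < Q by linarith)]
  have hb1 : 0 ≤ b := Real.log_nonneg (by rw [le_div_iff₀ hδ0]; linarith)
  have hbL : b ≤ L := by
    refine Real.log_le_log (by positivity) ?_
    rw [div_le_div_iff₀ hδ0 (by positivity)]
    have h1 : ε * (k * δ) ≤ (d + 1) * (k * δ) :=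
      mul_le_mul_of_nonneg_right (by linarith) (by positivity)
    linarith
  have hL0 : 0 ≤ L := hb1.trans hbL
  have hW0 : 0 ≤ Real.log (1 + L) := Real.log_nonneg (by linarith)
  have hΛ1 : 1 ≤ Λ := by linarith
  have hΛW : Λ ≤ 1 + L := by linarith [Real.log_le_sub_one_of_pos (show 0 < 1 + L by linarith)]
  have hεQ : 1 / ε ≤ Q := by rw [hQ]; gcongr
  have hdQ : d ≤ Q := by
    rw [hQ, le_div_iff₀ hε0]
    exact mul_le_mul_of_nonneg_left (by linarith) (by linarith)
  have hkQ : k ≤ Q := by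
    rw [hQ, le_div_iff₀ hε0, mul_comm (d : ℝ)]
    exact mul_le_mul_of_nonneg_left (by linarith) hk0.le
  clear_value Λ L b a Q
  obtain ⟨S, hS⟩ : ∃ S : ℝ, S = d * a * Λ + k * b + k := ⟨_, rfl⟩
  have hS0 : k ≤ S := by
    have : 0 ≤ d * a * Λ := by positivity
    have : 0 ≤ k * b := by positivity
    linarith
  have hS1 : 0 ≤ S := hk0.le.trans hS0
  have hNpos : 1 ≤ 900 * (1 / ε ^ 2) * (S / k) := by
    have h1 : 1 ≤ 1 / ε ^ 2 := by
      rw [le_div_iff₀ (by positivity), one_mul]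
      exact pow_le_one₀ hε0.le (by linarith)
    have h2 : 1 ≤ S / k := by rw [le_div_iff₀ hk0]; linarith
    linarith [one_le_mul_of_one_le_of_one_le h1 h2]
  obtain ⟨n, hn1, hn2⟩ := exists_nat_pow_near hNpos (show (1 : ℝ) < 2 by norm_num)
  set N : ℝ := 2 ^ (n + 1) with hN
  have hN0 : 0 ≤ N := by rw [hN]; positivity
  clear_value N
  have hNlow : 900 * (1 / ε ^ 2) * (S / k) ≤ N := hn2.le
  have hNup : N ≤ 2 * (900 * (1 / ε ^ 2) * (S / k)) := by rw [hN, pow_succ]; linarith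
  have hkNlow : 50 * S ≤ 2 * (ε / 6) ^ 2 * (k * N) := by
    have h1 := mul_le_mul_of_nonneg_left hNlow (show 0 ≤ 2 * (ε / 6) ^ 2 * k by positivity)
    calc 50 * S = 2 * (ε / 6) ^ 2 * k * (900 * (1 / ε ^ 2) * (S / k)) := by field_simp; ring
      _ ≤ _ := by linarith
  have hkNup : k * N ≤ 1800 * (1 / ε ^ 2) * S := by
    have h1 := mul_le_mul_of_nonneg_left hNup hk0.le
    calc k * N ≤ _ := h1
      _ = _ := by field_simp; ring
  -- `N` is polynomial in `Q` and `L`, so its logarithm is of the order `a * Λ`.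
  have hlog : Real.log (4 * k * N + 1) ≤ 50 * (a * Λ) := by
    have hQQ : Q ≤ Q ^ 2 := by nlinarith
    have h1 : S ≤ 3 * (Q ^ 2 * (1 + L)) := by
      have g1 : d * a * Λ ≤ Q * Q * (1 + L) := by gcongr
      have g2 : k * b ≤ Q ^ 2 * L := by gcongr; linarith
      have g3 : 0 ≤ Q ^ 2 * L := by positivity
      rw [hS]
      linarith
    have h2 : 1 / ε ^ 2 ≤ Q ^ 2 := by
      rw [← one_div_pow]; gcongr
    have g1 : 1800 * (1 / ε ^ 2) * S ≤ 1800 * Q ^ 2 * (3 * (Q ^ 2 * (1 + L))) := by gcongr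
    have g2 : 1 ≤ Q ^ 4 * (1 + L) :=
      one_le_mul_of_one_le_of_one_le (one_le_pow₀ (by linarith)) (by linarith)
    rw [ha, hΛ]
    refine log_le_of_le_polynomial hQ2 hL0 (by positivity) ?_
    have g3 : 1800 * Q ^ 2 * (3 * (Q ^ 2 * (1 + L))) = 5400 * (Q ^ 4 * (1 + L)) := by ring
    linarith
  have hdaΛ : 0 ≤ d * a * Λ := by positivity
  have hkb : 0 ≤ k * b := by positivity
  refine ⟨n + 1, ?_, ?_⟩
  · have hcast : ((2 ^ (n + 1) : ℕ) : ℝ) = N := by rw [hN]; push_cast; rfl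
    rw [hcast]
    refine epoch_failure_le hk hN0 ⟨hδ0, hδ1⟩ ?_ ?_
    · refine le_of_mul_le_mul_left ?_ hk0
      have h1 : k * (3 + 2 * b) = 3 * k + 2 * (k * b) := by ring
      have h2 : k * (2 * (ε / 6) ^ 2 * N) = 2 * (ε / 6) ^ 2 * (k * N) := by ring
      rw [← hb, h1, h2]
      linarith
    · have h1 := mul_le_mul_of_nonneg_left hlog (show (0 : ℝ) ≤ d by positivity)
      have h2 : d * (50 * (a * Λ)) = 50 * (d * a * Λ) := by ring
      have h3 : 4 * k * (b + 1) = 4 * (k * b) + 4 * k := by ring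
      rw [← hb, h3]
      linarith
  · have hR := epochLength_le_log hk
    -- The term `k` of `S` is absorbed: by `d * a` if `k = 1`, and by `k * b` otherwise.
    have hkT : (k : ℝ) ≤ 2 * ((d * a + k * b) * Λ) := by
      rcases Nat.eq_or_lt_of_le hk with h1 | h1
      · have : (k : ℝ) = 1 := by exact_mod_cast h1.symm
        have g1 : 1 * Real.log 2 ≤ d * a := by gcongr
        have g2 : (d * a + k * b) * 1 ≤ (d * a + k * b) * Λ := by gcongr
        linarith
      · have h2 : (2 : ℝ) ≤ k := by exact_mod_cast h1
        have g1 : Real.log 2 ≤ b := by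
          rw [hb]
          refine Real.log_le_log (by norm_num) ?_
          rw [le_div_iff₀ hδ0]
          linarith
        have g2 : (d * a + k * b) * 1 ≤ (d * a + k * b) * Λ := by gcongr
        have g3 : 0 ≤ d * a := by positivity
        have g4 : k * 0.69 ≤ k * b := by gcongr; linarith
        linarith
    have hST : S ≤ 3 * ((d * a + k * b) * Λ) := by
      have : k * b ≤ k * b * Λ := le_mul_of_one_le_right hkb hΛ1
      have h2 : (d * a + k * b) * Λ = d * a * Λ + k * b * Λ := by ring
      rw [hS]
      linarith
    have hmax : 0 ≤ max 1 (Real.log k) := le_trans zero_le_one (le_max_left _ _)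
    have he : 0 ≤ 1 / ε ^ 2 := by positivity
    have hkN0 : 0 ≤ k * N := mul_nonneg hk0.le hN0
    have hT0 : 0 ≤ (d * a + k * b) * Λ := by linarith
    have g1 : k * N ≤ 5400 * ((1 / ε ^ 2) * ((d * a + k * b) * Λ)) := by
      have := mul_le_mul_of_nonneg_left hST he
      linarith
    have g2 := mul_le_mul hR g1 hkN0 (by positivity)
    have g3 : 0 ≤ 1 / ε ^ 2 * max 1 (Real.log k) * ((d * a + k * b) * Λ) :=
      mul_nonneg (mul_nonneg he hmax) hT0
    calc (12 * k * epochLength k * 2 ^ (n + 1) : ℝ) = 12 * (epochLength k * (k * N)) := by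
          rw [hN]; ring
      _ ≤ 12 * (3 * max 1 (Real.log k) * (5400 * ((1 / ε ^ 2) * ((d * a + k * b) * Λ)))) := by
          linarith
      _ = 194400 * (1 / ε ^ 2 * max 1 (Real.log k) * ((d * a + k * b) * Λ)) := by ring
      _ ≤ 200000 * (1 / ε ^ 2 * max 1 (Real.log k) * ((d * a + k * b) * Λ)) := by linarith
      _ = _ := by ring

/-- The case `d = 0` relies on `0 * Real.log 0 = 0`. -/
theorem sampleBound_nonneg {k d : ℕ} (hk : 1 ≤ k) {ε δ : ℝ} (hε : ε ∈ Set.Ioo (0 : ℝ) 1)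
    (hδ : δ ∈ Set.Ioo (0 : ℝ) 1) :
    0 ≤ 200000 * ((1 / ε ^ 2) * max 1 (Real.log k) *
          (d * Real.log (d * k / ε) + k * Real.log (k / δ))) *
          (1 + Real.log (1 + Real.log ((d + 1) * k / (ε * δ)))) := by
  obtain ⟨hε0, hε1⟩ := hε
  obtain ⟨hδ0, hδ1⟩ := hδ
  have hk1 : (1 : ℝ) ≤ k := by exact_mod_cast hk
  have hd0 : (0 : ℝ) ≤ d := by positivity
  have h1 : 0 ≤ d * Real.log (d * k / ε) := by
    rcases Nat.eq_zero_or_pos d with rfl | hd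
    · simp
    · have hd1 : (1 : ℝ) ≤ d := by exact_mod_cast hd
      have : 1 ≤ d * k / ε := by rw [le_div_iff₀ hε0]; nlinarith
      have := Real.log_nonneg this
      positivity
  have h2 : 0 ≤ Real.log (k / δ) := Real.log_nonneg (by rw [le_div_iff₀ hδ0]; linarith)
  have h3 : 0 ≤ Real.log ((d + 1) * k / (ε * δ)) := by
    refine Real.log_nonneg ?_
    rw [le_div_iff₀ (by positivity)]
    nlinarith
  have h4 : 0 ≤ Real.log (1 + Real.log ((d + 1) * k / (ε * δ))) := Real.log_nonneg (by linarith)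
  have h5 : 0 ≤ max 1 (Real.log k) := le_trans zero_le_one (le_max_left _ _)
  positivity

theorem theorem2 :
    ∃ (C : ℝ) (p : ℕ), 0 < C ∧
      ∀ (X : Type*) [MeasurableSpace X] (H : Set (X → Bool)) (d : ℕ)
        (ℓ : Bool → X × Bool → ℝ),
        H.Nonempty → MeasurableClass H → classVCDim H = (d : ℕ∞) →
        (∀ y, Measurable (ℓ y)) → (∀ y z, ℓ y z ∈ Set.Icc (0 : ℝ) 1) →
        ∃ m : ℝ → ℝ → ℕ → ℕ,
          PersonalizedLearnable ℓ H m ∧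
          ∀ ε ∈ Set.Ioo (0 : ℝ) 1, ∀ δ ∈ Set.Ioo (0 : ℝ) 1, ∀ k : ℕ, 1 ≤ k →
            (m ε δ k : ℝ) ≤
              C * ((1 / ε ^ 2) * max 1 (Real.log k) *
                (d * Real.log (d * k / ε) + k * Real.log (k / δ))) *
              (1 + Real.log (1 + Real.log ((d + 1) * k / (ε * δ)))) ^ p := by
  refine ⟨200000, 1, by norm_num, ?_⟩
  intro X _ H d ℓ hne hH hd hℓ h01
  simp only [pow_one]
  rcases Nat.eq_zero_or_pos d with rfl | hdpos
  · -- A class of VC dimension zero has a single hypothesis, which is returned without any query.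
    obtain ⟨f, hf⟩ := hne
    refine ⟨fun _ _ _ => 0, fun k hk => ⟨⟨fun _ => ⟨0, hk⟩, fun _ _ x => PMF.pure (f x),
      fun _ _ y => (measurable_of_countable fun b : Bool => PMF.pure b y).comp
        (hH.measurable_mem f hf)⟩, ?_⟩, ?_⟩
    · intro ε hε δ _ D _
      refine (measure_mono (t := ∅) ?_).trans (by simp)
      intro ω hω
      refine (hω fun i => ?_).elim
      rw [risk_pure, add_comm]
      refine le_opt_add D ⟨f, hf⟩ i fun g hg => ?_
      rw [eq_of_mem_of_classVCDim_eq_zero (by simpa using hd) hf hg]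
      linarith [hε.1]
    · intro ε hε δ hδ k hk
      simpa using sampleBound_nonneg (d := 0) hk hε hδ
  -- On an empty space the VC dimension would be zero.
  have hX : Nonempty X := by
    by_contra hX
    rw [not_nonempty_iff] at hX
    have : classVCDim H = 0 := by
      refine le_antisymm (iSup₂_le fun S _ => ?_) zero_le
      simp [Finset.eq_empty_of_isEmpty S]
    rw [hd] at this
    have : d = 0 := by exact_mod_cast this
    omega
  have hm : ∀ (ε δ : ℝ) (k : ℕ), ∃ m : ℕ, ε ∈ Set.Ioo (0 : ℝ) 1 → δ ∈ Set.Ioo (0 : ℝ) 1 → 1 ≤ k →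
      ((m : ℝ) ≤ 200000 * ((1 / ε ^ 2) * max 1 (Real.log k) *
          (d * Real.log (d * k / ε) + k * Real.log (k / δ))) *
          (1 + Real.log (1 + Real.log ((d + 1) * k / (ε * δ))))) ∧
      ((1 / 2 ≤ ε ∧ m = 0) ∨ ε < 1 / 2 ∧ ∃ j : ℕ,
        m = roundStart k (epochLength k) ((j + 1) * epochLength k) ∧
        (epochLength k : ℝ) * (3 * ((4 * k * (2 ^ j : ℕ) + 1) ^ d * (2 * k).factorial *
        Real.exp (-2 * (ε / 6) ^ 2 * (k * (2 ^ j : ℕ)))) +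
        4 * k * Real.exp (-2 * (ε / 6) ^ 2 * (2 ^ j : ℕ))) ≤ δ) := by
    intro ε δ k
    by_cases h : ε ∈ Set.Ioo (0 : ℝ) 1 ∧ δ ∈ Set.Ioo (0 : ℝ) 1 ∧ 1 ≤ k
    swap
    · exact ⟨0, fun h1 h2 h3 => absurd ⟨h1, h2, h3⟩ h⟩
    obtain ⟨hε, hδ, hk⟩ := h
    rcases le_or_gt (1 / 2) ε with hε2 | hε2
    · refine ⟨0, fun _ _ _ => ⟨?_, Or.inl ⟨hε2, rfl⟩⟩⟩
      simpa using sampleBound_nonneg (d := d) hk hε hδ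
    · obtain ⟨j, hj1, hj2⟩ := exists_epoch hk hdpos ⟨hε.1, hε2⟩ hδ
      refine ⟨_, fun _ _ _ => ⟨le_trans ?_ hj2, Or.inr ⟨hε2, j, rfl, hj1⟩⟩⟩
      exact_mod_cast roundStart_le
  choose m hm using hm
  refine ⟨m, ?_, fun ε hε δ hδ k hk => (hm ε δ k hε hδ hk).1⟩
  intro k hk
  have : NeZero k := ⟨by omega⟩
  obtain ⟨A, hA⟩ := exists_roundRule hne hH hd.le hℓ h01 hk
  refine ⟨A.learner (epochLength k), ?_⟩
  intro ε hε δ hδ D _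
  obtain ⟨-, ⟨hε2, h0⟩ | ⟨hε2, j, hj, hfail⟩⟩ := hm ε δ k hε hδ hk
  · -- Without any query the learner returns fair coins.
    rw [h0]
    refine (measure_mono (t := ∅) ?_).trans (by simp)
    intro ω hω
    refine (hω fun i => ?_).elim
    have hout : (A.learner (epochLength k)).output
        ((A.learner (epochLength k)).transcript 0 ω) i = fun _ => PMF.uniformOfFintype Bool := by
      funext x
      refine dif_neg ?_
      rintro ⟨g, ⟨j, hj, -⟩, -⟩
      have h1 := (roundStart_strictMono k (epochLength k)).le_apply
        (x := (j + 1) * epochLength k)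
      rw [← hj] at h1
      have h2 : 0 < (j + 1) * epochLength k :=
        Nat.mul_pos (Nat.succ_pos _) (Nat.succ_pos _)
      exact absurd h1 (not_le.2 h2)
    rw [hout, add_comm]
    refine le_opt_add D hne i fun f hf => ?_
    linarith [risk_uniform_le hℓ h01 (D i) (hH.measurable_mem f hf)]
  · rw [hj]
    obtain ⟨f, hf, hfM⟩ := exists_detRisk_le_opt_add (ℓ := ℓ) D hne
      (show 0 < ε / 6 by linarith [hε.1])
    have hround := A.measure_learner_fails_le (epochLength k) (Nat.succ_pos _)
      (Nat.lt_pow_succ_log_self (by norm_num) k) ℓ D j (ε + opt ℓ H D)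
      (fun a => by
        have h := hA (2 ^ j) Nat.one_le_two_pow D f hf _ hfM (ε / 6) (by linarith [hε.1])
          (by linarith) a
        rw [show opt ℓ H D + ε / 6 + 5 * (ε / 6) = ε + opt ℓ H D by ring] at h
        exact h)
    refine hround.trans ?_
    rw [← ENNReal.ofReal_natCast, ← ENNReal.ofReal_mul (by positivity)]
    exact ENNReal.ofReal_le_ofReal hfail
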